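/- Let $n\ge 1$ and let $\Lambda\subset\mathbb E^n$ be a full-rank integral lattice, i.e. $\|\gamma\|^2\in\mathbb N=\{0,1,2,\dots\}$ for all $\gamma\in\Lambda$. Let $N$ be the level of $\Lambda$, i.e. the least positive integer such that $N\|y\|^2\in\mathbb Z$ for all $y\in\mathbb E^n$ with $2\langle x,y\rangle\in\mathbb Z$ for all $x\in\Lambda$ (equivalently, the least positive integer such that $NA^{-1}$ is integral with even diagonal, where $A=(2\langle b_i,b_j\rangle)$ for a $\mathbb Z$-basis $(b_i)$ of $\Lambda$). Let $k=\min\{\|\gamma\|^2 : 0\ne\gamma\in\Lambda\}$ be the first minimal length. For a polynomial $h$ on $\mathbb E^n$ and $\tau$ in the upper half plane put $q=e^{2\pi i\tau}$, $\Theta_{h,\Lambda}(\tau)=\sum_{\gamma\in\Lambda}h(\gamma)q^{\|\gamma\|^2}$, and define $$\Theta_{11,\Lambda}=2n^2\sum_{1\le i<j\le n}\Theta_{x_ix_j,\Lambda}^2+\sum_{i=1}^n\Theta_{nx_i^2-\sum_{j=1}^n x_j^2,\Lambda}^2 .$$ The theta series occurring here converge absolutely, and the following hold. 1. $\Theta_{11,\Lambda}$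 does not depend on the embedding: $\Theta_{11,\iota(\Lambda)}=\Theta_{11,\Lambda}$ for every norm-preserving additive map $\iota:\Lambda\to\mathbb E^n$. 2. $\Theta_{11,\Lambda}$ is a cusp form of weight $n+4$ and level $N$. Precisely: if $n$ is even, it is a cusp form of weight $n+4$ for $\Gamma_0(N)$ (with trivial character). If $n$ is odd, it is a cusp form of weight $n+4$ for $\Gamma_1(N)$ and satisfies $$\Theta_{11,\Lambda}\Big(\frac{a\tau+b}{c\tau+d}\Big)=\chi(d)\,(c\tau+d)^{n+4}\,\Theta_{11,\Lambda}(\tau)\quad\text{for all }\begin{pmatrix}a&b\\c&d\end{pmatrix}\in\Gamma_0(N),$$ where $\chi(d)=1$ if $d\equiv1$, $\chi(d)=-1$ if $d\equiv 3\pmod 4$, and $\chi(d)=0$ if $d$ is even. 3. $\Theta_{11,\Lambda}(\tau)=\sum_{m\ge0}a_mq^m$, where $$a_m=n^2\sum_{\substack{(\gamma,\delta)\in\Lambda\times\Lambda\\ \|\gamma\|^2+\|\delta\|^2=m}}\Big(\cos^2\angle(\gamma,\delta)-\frac1n\Big)\|\gamma\|^2\|\delta\|^2$$ is a finite sum (terms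 with $\gamma=0$ or $\delta=0$ are $0$). 4. All $a_m$ are integers, and the power series $\sum_m a_mq^m$ lies in the ideal $2n\,q^{2k}\,\mathbb Z[[q]]$ of $\mathbb Z[[q]]$; if $n$ is even, it lies in $4n\,q^{2k}\,\mathbb Z[[q]]$. -/

import Mathlib

open scoped MatrixGroups ModularForm

namespace LatticeTheta

/-- A lattice is integral if all squared norms of its vectors are natural numbers. -/
def IsIntegral {n : ℕ} (Λ : Submodule ℤ (EuclideanSpace ℝ (Fin n))) : Prop :=
  ∀ γ ∈ Λ, ∃ m : ℕ, ‖γ‖ ^ 2 = (m : ℝ)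

/-- The dual of `Λ` for the bilinear form `2⟨x, y⟩` whose quadratic form is `‖x‖²`
(that is, `2⟨x, y⟩ = ‖x + y‖² - ‖x‖² - ‖y‖²`). -/
def dual {n : ℕ} (Λ : Submodule ℤ (EuclideanSpace ℝ (Fin n))) :
    Set (EuclideanSpace ℝ (Fin n)) :=
  {y | ∀ x ∈ Λ, ∃ m : ℤ, 2 * inner ℝ x y = (m : ℝ)}

/-- `N` is the level of the integral lattice `Λ`: the least positive integer `N` such that
`N‖y‖²` is an integer for every `y` in the dual. In terms of a basis with even Gram matrix
`A = (2⟨bᵢ, bⱼ⟩)`, the dual consists of the vectors with coordinates `A⁻¹ v`, `v ∈ ℤⁿ`, whose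
squared norm is `vᵀ A⁻¹ v / 2`; so `N` is the least positive integer such that `N A⁻¹` has
integral entries and even diagonal entries. -/
def IsLevel {n : ℕ} (Λ : Submodule ℤ (EuclideanSpace ℝ (Fin n))) (N : ℕ) : Prop :=
  IsLeast {N : ℕ | 0 < N ∧ ∀ y ∈ dual Λ, ∃ m : ℤ, (N : ℝ) * ‖y‖ ^ 2 = (m : ℝ)} N

/-- `k` is the first minimal length: the least value of `‖γ‖²` on the nonzero vectors. -/
def IsMinimalLength {n : ℕ} (Λ : Submodule ℤ (EuclideanSpace ℝ (Fin n))) (k : ℕ) : Prop :=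
  IsLeast {l : ℕ | ∃ γ ∈ Λ, γ ≠ 0 ∧ ‖γ‖ ^ 2 = (l : ℝ)} k

/-- The term `h(γ) q^{‖γ‖²}`, `q = exp(2πiτ)`, of the spherical theta series. -/
noncomputable def thetaTerm {n : ℕ} (h : EuclideanSpace ℝ (Fin n) → ℝ) (τ : UpperHalfPlane)
    (γ : EuclideanSpace ℝ (Fin n)) : ℂ :=
  (h γ : ℂ) * Complex.exp (2 * Real.pi * Complex.I * (τ : ℂ) * ((‖γ‖ ^ 2 : ℝ) : ℂ))

/-- The theta series `∑_{γ ∈ Λ} h(γ) q^{‖γ‖²}`. -/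
noncomputable def theta {n : ℕ} (h : EuclideanSpace ℝ (Fin n) → ℝ)
    (Λ : Submodule ℤ (EuclideanSpace ℝ (Fin n))) (τ : UpperHalfPlane) : ℂ :=
  ∑' γ : Λ, thetaTerm h τ (γ : EuclideanSpace ℝ (Fin n))

/-- The harmonic polynomial `xᵢ xⱼ` (for `i ≠ j`). -/
def mixed {n : ℕ} (i j : Fin n) (x : EuclideanSpace ℝ (Fin n)) : ℝ :=
  x i * x j

/-- The harmonic polynomial `n xᵢ² - ∑ⱼ xⱼ²`. -/
def diag {n : ℕ} (i : Fin n) (x : EuclideanSpace ℝ (Fin n)) : ℝ :=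
  (n : ℝ) * x i ^ 2 - ∑ j, x j ^ 2

/-- The function `Θ₁₁,Λ` on the upper half plane. -/
noncomputable def theta11 {n : ℕ} (Λ : Submodule ℤ (EuclideanSpace ℝ (Fin n)))
    (τ : UpperHalfPlane) : ℂ :=
  2 * (n : ℂ) ^ 2 * (∑ i : Fin n, ∑ j ∈ Finset.Ioi i, theta (mixed i j) Λ τ ^ 2)
    + ∑ i : Fin n, theta (diag i) Λ τ ^ 2

/-- The pairs `(γ, δ) ∈ Λ × Λ` with `‖γ‖² + ‖δ‖² = m`. -/
def pairs {n : ℕ} (Λ : Submodule ℤ (EuclideanSpace ℝ (Fin n))) (m : ℕ) :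
    Set (EuclideanSpace ℝ (Fin n) × EuclideanSpace ℝ (Fin n)) :=
  {p | p.1 ∈ Λ ∧ p.2 ∈ Λ ∧ ‖p.1‖ ^ 2 + ‖p.2‖ ^ 2 = (m : ℝ)}

/-- `a_m = n² ∑ (cos² ∠(γ, δ) - 1/n) ‖γ‖² ‖δ‖²`, the (finite) sum being over `pairs Λ m`. -/
noncomputable def coeff11 {n : ℕ} (Λ : Submodule ℤ (EuclideanSpace ℝ (Fin n))) (m : ℕ) : ℝ :=
  (n : ℝ) ^ 2 * ∑ᶠ p ∈ pairs Λ m,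
    (Real.cos (InnerProductGeometry.angle p.1 p.2) ^ 2 - 1 / (n : ℝ)) * ‖p.1‖ ^ 2 * ‖p.2‖ ^ 2

end LatticeTheta

/-!
`Θ₁₁` is a combination of squares `Θ_h²` of theta series, `h` running through quadratic forms of
trace `0`, that is, harmonic quadratic forms. Two descriptions of it carry the proof.

*Modularity.* Poisson summation on the lattice (`exists_hasSum_poisson_basis`) and the Fourier
transform of `h` times a Gaussian (`integral_phase_mul_quadForm_mul_gauss`, where harmonicity kills
the trace term) give the inversion formula for shifted lattices. Splitting `Λ` into classes modulo
`m` then expands `Θ_h(a/m + u)` as a theta series of the dual lattice twisted by the Gauss sums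
`G(y) = ∑_{ρ ∈ Λ/mΛ} e((a‖ρ‖² + 2⟨y, ρ⟩)/m)` (`exists_theta_expansion_at_rational`).

For a matrix in `Γ₀(N)` with lower row `(c, p)`, `p` prime, completing the square reduces `G(y)` to
`G(0)`, so `Θ_h²` is multiplied by the factor `G(0)² p⁻ⁿ (cτ + p)^{n+4}`. If moreover
`p ≡ 1 (mod 4)`, then `G(0)` is real, because `-1` is a square modulo `p`, and `|G(0)|² = pⁿ`, so
`G(0)² = pⁿ`; no quadratic reciprocity or determination of quadratic characters is needed
(`latGauss_zero_sq`, `quadTheta_sq_transform`). By Dirichlet's theorem every lower row `(c, d)` with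
`c ≠ 0` and either `4 ∤ c` or `d ≡ 1 (mod 4)` becomes of this type after a translation
`τ ↦ τ + j`, and the remaining matrices are translations or differ from these by the sign `-1`,
which acts by `(-1)ⁿ` (`theta11_slash_of_even`, `theta11_slash_of_odd`). Working with squares
throughout makes the choice of a square root `(cτ + d)^{n/2}` irrelevant. At the cusp `a/c` the same expansion writes
`Θ_h²` in terms of a twisted theta series of the dual lattice whose terms carry the weight `h`,
which is `0` at the origin; so it tends to `0` (`isZeroAtImInfty_theta11_slash_SL2`).

*The `q`-expansion.* The identity `zonal_eq_sum` turns `Θ₁₁` into the double theta series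
`∑_{γ, δ} (n²⟨γ, δ⟩² - n‖γ‖²‖δ‖²) q^{‖γ‖² + ‖δ‖²}`, which only involves inner products. This gives
the independence of the embedding and the formula for the coefficients. The sign changes of `γ`
and `δ` contribute a factor `4`, and the swap `(γ, δ) ↦ (δ, γ)` shows that the sum of the squares
`(2⟨γ, δ⟩)²` over a half system is even (`exists_coeff11_eq`), whence the divisibility.
-/

namespace LatticeTheta

/-! ### Poisson summation on `ℤ^ι` -/

section PoissonSummation

open MeasureTheory Set

/-- The real vector with the integer coordinates `m`. -/
def intVec {ι : Type*} (m : ι → ℤ) : ι → ℝ := fun i => (m i : ℝ)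

/-- Comparison with `ZLattice.summable_norm_sub_rpow` for the standard lattice `ℤ^ι`. -/
lemma summable_intVec {ι : Type*} [Fintype ι] {r : ℝ} (hr : (Fintype.card ι : ℝ) < r) :
    Summable fun m : ι → ℤ => (1 + ‖intVec m‖) ^ (-r) := by
  let b := Pi.basisFun ℝ ι
  let L := Submodule.span ℤ (range b)
  let b' : Module.Basis ι ℤ L := b.restrictScalars ℤ
  have hfin : Module.finrank ℤ L = Fintype.card ι := Module.finrank_eq_card_basis b'
  have hr0 : 0 < r := lt_of_le_of_lt (by positivity) hr
  have h1 := ZLattice.summable_norm_sub_rpow L (-r) (by rw [hfin]; linarith) 0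
  have h2 : Summable fun m : ι → ℤ => ‖intVec m‖ ^ (-r) := by
    have := (b'.equivFun.symm.toEquiv.summable_iff).mpr h1
    refine this.congr fun m => ?_
    have : ((b'.equivFun.symm m : L) : ι → ℝ) = intVec m := by
      rw [Module.Basis.equivFun_symm_apply]
      ext i
      have hb : ∀ j, ((b' j : L) : ι → ℝ) = Pi.basisFun ℝ ι j :=
        fun j => Module.Basis.restrictScalars_apply ℤ b j
      classical
      simp [hb, intVec, Finset.sum_apply, Pi.single_apply]
    rw [Function.comp_apply, sub_zero]
    exact congrArg (fun v : ι → ℝ => ‖v‖ ^ (-r)) this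
  refine Summable.of_norm_bounded_eventually h2 ?_
  have : ∀ m : ι → ℤ, m ≠ 0 → ‖(1 + ‖intVec m‖) ^ (-r)‖ ≤ ‖intVec m‖ ^ (-r) := by
    intro m hm
    have hpos : 0 < ‖intVec m‖ := by
      rw [norm_pos_iff]
      intro h
      apply hm
      ext i
      have := congrFun h i
      simpa [intVec] using this
    rw [Real.norm_of_nonneg (by positivity)]
    exact Real.rpow_le_rpow_of_nonpos hpos (by linarith) (by linarith)
  refine (Set.finite_singleton (0 : ι → ℤ)).subset ?_
  intro m hm
  by_contra h
  exact hm (this m h)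

/-- Changing the centre of a polynomially decaying weight by `y` costs a bounded factor. -/
lemma rpow_one_add_norm_add_le {E : Type*} [NormedAddCommGroup E] {r R : ℝ} (hr : 0 ≤ r)
    {x y : E} (hy : ‖y‖ ≤ R) :
    (1 + ‖y + x‖) ^ (-r) ≤ (1 + R) ^ r * (1 + ‖x‖) ^ (-r) := by
  have hR : 0 ≤ R := (norm_nonneg y).trans hy
  have h1 : ‖x‖ ≤ ‖y + x‖ + R := by
    calc ‖x‖ = ‖(y + x) - y‖ := by simp
      _ ≤ ‖y + x‖ + ‖y‖ := norm_sub_le _ _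
      _ ≤ _ := by linarith
  have h2 : 1 + ‖x‖ ≤ (1 + R) * (1 + ‖y + x‖) := by nlinarith [norm_nonneg (y + x)]
  have h3 : (1 + ‖x‖) ^ r ≤ (1 + R) ^ r * (1 + ‖y + x‖) ^ r := by
    rw [← Real.mul_rpow (by positivity) (by positivity)]
    exact Real.rpow_le_rpow (by positivity) h2 hr
  rw [Real.rpow_neg (by positivity), Real.rpow_neg (by positivity), ← div_eq_mul_inv,
    inv_le_comm₀ (by positivity) (by positivity), inv_div, div_le_iff₀ (by positivity)]
  linarith

lemma periodization_add {ι : Type*} (g : (ι → ℝ) → ℂ) (x : ι → ℝ) (l : ι → ℤ) :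
    ∑' m : ι → ℤ, g (x + intVec l + intVec m) = ∑' m : ι → ℤ, g (x + intVec m) := by
  rw [← (Equiv.addLeft l).tsum_eq (fun m => g (x + intVec m))]
  refine tsum_congr fun m => ?_
  congr 1
  ext i
  simp [intVec, add_assoc]

section Poisson

variable {ι : Type*} [Fintype ι] {f : (ι → ℝ) → ℂ} {C r : ℝ}

lemma norm_translate_le (hr : (Fintype.card ι : ℝ) < r)
    (hf : ∀ x, ‖f x‖ ≤ C * (1 + ‖x‖) ^ (-r)) (R : ℝ) (m : ι → ℤ) (x : ι → ℝ) (hx : ‖x‖ ≤ R) :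
    ‖f (x + intVec m)‖ ≤ C * (1 + R) ^ r * (1 + ‖intVec m‖) ^ (-r) := by
  have hC : 0 ≤ C := by
    have := (norm_nonneg _).trans (hf 0)
    simpa using this
  refine (hf _).trans ?_
  rw [mul_assoc]
  exact mul_le_mul_of_nonneg_left
    (rpow_one_add_norm_add_le (le_trans (by positivity) hr.le) hx) hC

lemma continuous_periodization (hr : (Fintype.card ι : ℝ) < r) (hc : Continuous f)
    (hf : ∀ x, ‖f x‖ ≤ C * (1 + ‖x‖) ^ (-r)) :
    Continuous fun x : ι → ℝ => ∑' m : ι → ℤ, f (x + intVec m) := by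
  rw [continuous_iff_continuousAt]
  intro x
  have : ContinuousOn (fun x : ι → ℝ => ∑' m : ι → ℤ, f (x + intVec m))
      (Metric.ball 0 (‖x‖ + 1)) := by
    refine continuousOn_tsum (u := fun m => C * (1 + (‖x‖ + 1)) ^ r * (1 + ‖intVec m‖) ^ (-r))
      (fun m => (hc.comp (by fun_prop)).continuousOn) ((summable_intVec hr).mul_left _) ?_
    intro m y hy
    exact norm_translate_le hr hf _ m y (by simpa using (mem_ball_zero_iff.mp hy).le)
  exact this.continuousAt (Metric.isOpen_ball.mem_nhds (by simp))

/-- The translates by `ℤ^ι` of the half-open unit cube tile the space. -/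
lemma integral_eq_tsum_cube (g : (ι → ℝ) → ℂ) (hg : Integrable g) :
    HasSum (fun m : ι → ℤ => ∫ x in {x : ι → ℝ | ∀ i, x i ∈ Ioc (0 : ℝ) (0 + 1)},
      g (x + intVec m)) (∫ x, g x) := by
  set s : (ι → ℤ) → Set (ι → ℝ) := fun m => {x | ∀ i, x i ∈ Ioc (m i : ℝ) (m i + 1)} with hs
  have hmeas : ∀ m, MeasurableSet (s m) := fun m =>
    MeasurableSet.univ_pi' fun i => measurableSet_Ioc
  have huniv : ⋃ m, s m = univ := by
    refine eq_univ_of_forall fun x => mem_iUnion.mpr ⟨fun i => ⌈x i⌉ - 1, fun i => ?_⟩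
    have h1 := Int.ceil_lt_add_one (x i)
    have h2 := Int.le_ceil (x i)
    simp only [mem_Ioc]
    push_cast
    constructor <;> linarith
  have hdisj : Pairwise (Function.onFun Disjoint s) := by
    intro m m' hmm
    rw [Function.onFun, Set.disjoint_left]
    intro x hx hx'
    apply hmm
    ext i
    have h1 := hx i
    have h2 := hx' i
    simp only [mem_Ioc] at h1 h2
    have h3 : (m i : ℝ) < m' i + 1 := by linarith
    have h4 : (m' i : ℝ) < m i + 1 := by linarith
    norm_cast at h3 h4
    omega
  have h := hasSum_integral_iUnion (μ := volume) (f := g) hmeas hdisj hg.integrableOn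
  rw [huniv, Measure.restrict_univ] at h
  refine h.congr_fun fun m => ?_
  have hmp : MeasurePreserving (fun x : ι → ℝ => x + intVec m) volume volume :=
    measurePreserving_add_right _ _
  rw [← hmp.setIntegral_preimage_emb
    (MeasurableEquiv.addRight (intVec m)).measurableEmbedding g (s m)]
  congr 2
  ext x
  simp only [hs, intVec, mem_ofPred_eq, mem_preimage, Pi.add_apply, mem_Ioc]
  refine forall_congr' fun i => ⟨fun h => ⟨by linarith, by linarith⟩,
    fun h => ⟨by linarith, by linarith⟩⟩

lemma mFourier_coe (k : ι → ℤ) (x : ι → ℝ) :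
    UnitAddTorus.mFourier k (fun i => (x i : UnitAddCircle)) =
      Complex.exp (2 * Real.pi * Complex.I * ∑ i, (k i : ℂ) * x i) := by
  simp only [UnitAddTorus.mFourier, ContinuousMap.coe_mk]
  rw [Finset.mul_sum, Complex.exp_sum]
  refine Finset.prod_congr rfl fun i _ => ?_
  rw [fourier_coe_apply]
  simp [mul_assoc]

lemma exp_intVec (k m : ι → ℤ) (x : ι → ℝ) :
    Complex.exp (2 * Real.pi * Complex.I * ∑ i, (k i : ℂ) * ((x + intVec m) i : ℝ)) =
      Complex.exp (2 * Real.pi * Complex.I * ∑ i, (k i : ℂ) * x i) := by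
  rw [Complex.exp_eq_exp_iff_exists_int]
  refine ⟨∑ i, k i * m i, ?_⟩
  simp only [intVec, Pi.add_apply, Complex.ofReal_add, Complex.ofReal_intCast, mul_add,
    Finset.sum_add_distrib, Int.cast_sum, Int.cast_mul]
  ring

/-- Poisson summation on `ℤ^ι ⊂ ℝ^ι`, for a continuous function with polynomial decay whose
Fourier coefficients are summable: the Fourier series of the periodization converges to it. -/
theorem hasSum_poisson (hr : (Fintype.card ι : ℝ) < r) (hc : Continuous f)
    (hf : ∀ x, ‖f x‖ ≤ C * (1 + ‖x‖) ^ (-r)) {c : (ι → ℤ) → ℂ}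
    (hcoef : ∀ k, c k = ∫ x : ι → ℝ,
      Complex.exp (2 * Real.pi * Complex.I * ∑ i, ((-k) i : ℂ) * x i) * f x)
    (hsum : Summable c) (x : ι → ℝ) :
    HasSum (fun k : ι → ℤ =>
      c k * Complex.exp (2 * Real.pi * Complex.I * ∑ i, (k i : ℂ) * x i))
      (∑' m : ι → ℤ, f (x + intVec m)) := by
  set F : (ι → ℝ) → ℂ := fun x => ∑' m : ι → ℤ, f (x + intVec m) with hF
  -- `F` descends to a continuous function `G` on the torus, whose Fourier coefficients unfold to
  -- the integrals `c k` over the whole space.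
  let G : UnitAddTorus ι → ℂ := fun t => F fun i => ((AddCircle.equivIco 1 0 (t i) : ℝ))
  have hGF : ∀ x : ι → ℝ, G (fun i => (x i : UnitAddCircle)) = F x := by
    intro x
    have : ∀ i, ∃ l : ℤ, x i = (AddCircle.equivIco 1 0 (x i : UnitAddCircle) : ℝ) + l := by
      intro i
      have h : ((AddCircle.equivIco 1 0 (x i : UnitAddCircle) : ℝ) : UnitAddCircle) = x i :=
        AddCircle.coe_equivIco
      obtain ⟨l, hl⟩ := AddSubgroup.mem_zmultiples_iff.mp (QuotientAddGroup.eq.mp h)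
      refine ⟨l, ?_⟩
      rw [zsmul_eq_mul, mul_one] at hl
      linarith
    choose l hl using this
    have hx : x = (fun i => (AddCircle.equivIco 1 0 (x i : UnitAddCircle) : ℝ)) + intVec l := by
      ext i
      exact hl i
    conv_rhs => rw [hx]
    exact (periodization_add f _ l).symm
  have hGc : Continuous G := by
    have hq : IsOpenQuotientMap (Pi.map fun (_ : ι) (t : ℝ) => (t : UnitAddCircle)) :=
      IsOpenQuotientMap.piMap fun i => QuotientAddGroup.isOpenQuotientMap_mk
    rw [hq.isQuotientMap.continuous_iff]
    have : G ∘ (Pi.map fun (_ : ι) (t : ℝ) => (t : UnitAddCircle)) = F := funext hGF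
    rw [this]
    exact continuous_periodization hr hc hf
  have hfi : Integrable f := by
    have := (integrable_one_add_norm (E := ι → ℝ) (μ := volume) (r := r) (by simpa using hr))
    exact (this.const_mul C).mono' hc.aestronglyMeasurable (Filter.Eventually.of_forall hf)
  have hcoefG : ∀ k, UnitAddTorus.mFourierCoeff G k = c k := by
    intro k
    rw [UnitAddTorus.mFourierCoeff_eq_integral G k 0, hcoef]
    set e : (ι → ℝ) → ℂ := fun x => Complex.exp (2 * Real.pi * Complex.I *
      ∑ i, ((-k) i : ℂ) * x i) with he
    have hnorm : ∀ x, ‖e x‖ = 1 := by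
      intro x
      rw [he]
      simp only
      rw [show 2 * (Real.pi : ℂ) * Complex.I * ∑ i, ((-k) i : ℂ) * x i
        = ((2 * Real.pi * ∑ i, ((-k) i : ℝ) * x i : ℝ) : ℂ) * Complex.I by push_cast; ring]
      exact Complex.norm_exp_ofReal_mul_I _
    have hec : Continuous e := by fun_prop
    have hgi : Integrable fun x => e x * f x :=
      hfi.bdd_mul hec.aestronglyMeasurable (Filter.Eventually.of_forall fun x => (hnorm x).le)
    have h1 := (integral_eq_tsum_cube _ hgi).tsum_eq
    have hper : ∀ m x, e (x + intVec m) = e x := fun m x => by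
      have := exp_intVec (-k) m x
      simpa [he] using this
    have hn : Integrable fun x => ((‖f x‖ : ℝ) : ℂ) := hfi.norm.ofReal
    have h2 := (integral_eq_tsum_cube _ hn).summable
    have h3 := hasSum_integral_of_summable_integral_norm
      (μ := volume.restrict {x : ι → ℝ | ∀ i, x i ∈ Ioc (0 : ℝ) (0 + 1)})
      (F := fun (m : ι → ℤ) (x : ι → ℝ) => e x * f (x + intVec m)) ?_ ?_
    · rw [← h1]
      simp only [hper]
      rw [h3.tsum_eq]
      refine integral_congr_ae (Filter.Eventually.of_forall fun x => ?_)
      simp only [smul_eq_mul]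
      rw [mFourier_coe, hGF, tsum_mul_left]
    · intro m
      have := (hgi.comp_add_right (intVec m)).restrict
        (s := {x : ι → ℝ | ∀ i, x i ∈ Ioc (0 : ℝ) (0 + 1)})
      simpa only [hper] using this
    · have h4 : Summable fun m : ι → ℤ =>
          ∫ x in {x : ι → ℝ | ∀ i, x i ∈ Ioc (0 : ℝ) (0 + 1)}, ‖f (x + intVec m)‖ := by
        rw [← Complex.summable_ofReal]
        refine h2.congr fun m => ?_
        exact integral_ofReal (f := fun x => ‖f (x + intVec m)‖)
      simpa only [norm_mul, hnorm, one_mul] using h4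
  have hs : Summable (UnitAddTorus.mFourierCoeff (⟨G, hGc⟩ : C(UnitAddTorus ι, ℂ))) := by
    refine hsum.congr fun k => ?_
    exact (hcoefG k).symm
  have := UnitAddTorus.hasSum_mFourier_series_apply_of_summable hs
    (fun i => (x i : UnitAddCircle))
  have h5 : (⟨G, hGc⟩ : C(UnitAddTorus ι, ℂ)) (fun i => (x i : UnitAddCircle)) = F x := hGF x
  rw [h5] at this
  refine this.congr_fun fun k => ?_
  rw [mFourier_coe, smul_eq_mul]
  congr 1
  exact (hcoefG k).symm

end Poisson

end PoissonSummation

/-! ### Gaussian decay and Poisson summation for lattices in Euclidean space -/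

section LatticePoisson

open MeasureTheory Set

lemma one_add_pow_mul_exp_le {a : ℝ} (ha : 0 < a) (k : ℕ) {t : ℝ} (ht : 0 ≤ t) :
    (1 + t) ^ k * Real.exp (-a * t ^ 2) ≤ k.factorial * Real.exp (1 + 1 / (4 * a)) := by
  have h1 : (1 + t) ^ k ≤ k.factorial * Real.exp (1 + t) := by
    have := Real.pow_div_factorial_le_exp (1 + t) (by linarith) k
    rwa [div_le_iff₀ (by positivity), mul_comm] at this
  have h2 : 1 + t + -a * t ^ 2 ≤ 1 + 1 / (4 * a) := by
    -- complete the square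
    have : 1 / (4 * a) - t + a * t ^ 2 = (2 * a * t - 1) ^ 2 / (4 * a) := by
      field_simp
      ring
    have h3 : 0 ≤ (2 * a * t - 1) ^ 2 / (4 * a) := by positivity
    linarith
  calc (1 + t) ^ k * Real.exp (-a * t ^ 2)
      ≤ k.factorial * Real.exp (1 + t) * Real.exp (-a * t ^ 2) := by gcongr
    _ = k.factorial * Real.exp (1 + t + -a * t ^ 2) := by rw [mul_assoc, ← Real.exp_add]
    _ ≤ _ := by gcongr

/-- Gaussian decay beats any power of `1 + t`, with an explicit constant. -/
lemma one_add_pow_mul_exp_le_rpow {a : ℝ} (ha : 0 < a) (j s : ℕ) {t : ℝ} (ht : 0 ≤ t) :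
    (1 + t) ^ j * Real.exp (-a * t ^ 2) ≤
      (j + s).factorial * Real.exp (1 + 1 / (4 * a)) * (1 + t) ^ (-(s : ℝ)) := by
  rw [Real.rpow_neg (by linarith), Real.rpow_natCast, ← div_eq_mul_inv,
    le_div_iff₀ (by positivity)]
  calc _ = (1 + t) ^ (j + s) * Real.exp (-a * t ^ 2) := by ring
    _ ≤ _ := one_add_pow_mul_exp_le ha _ ht

lemma rpow_one_add_norm_le_of_norm_le {E F : Type*} [NormedAddCommGroup E] [NormedAddCommGroup F]
    {K r : ℝ} (hr : 0 ≤ r) (hK : 1 ≤ K) {x : E} {v : F} (h : ‖x‖ ≤ K * ‖v‖) :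
    (1 + ‖v‖) ^ (-r) ≤ K ^ r * (1 + ‖x‖) ^ (-r) := by
  have h3 : (1 + ‖x‖) ^ r ≤ K ^ r * (1 + ‖v‖) ^ r := by
    rw [← Real.mul_rpow (by positivity) (by positivity)]
    exact Real.rpow_le_rpow (by positivity) (by linarith) hr
  rw [Real.rpow_neg (by positivity), Real.rpow_neg (by positivity), ← div_eq_mul_inv,
    inv_le_comm₀ (by positivity) (by positivity), inv_div, div_le_iff₀ (by positivity)]
  linarith

lemma summable_of_intVec_le {ι E : Type*} [Fintype ι] [NormedAddCommGroup E] {r K : ℝ}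
    (hr : (Fintype.card ι : ℝ) < r) {v : (ι → ℤ) → E} (h : ∀ m, ‖intVec m‖ ≤ K * ‖v m‖) :
    Summable fun m => (1 + ‖v m‖) ^ (-r) := by
  have hr0 : 0 ≤ r := le_trans (by positivity) hr.le
  refine Summable.of_nonneg_of_le (fun m => by positivity) (fun m => ?_)
    ((summable_intVec hr).mul_left ((max K 1) ^ r))
  exact rpow_one_add_norm_le_of_norm_le hr0 (le_max_right _ _)
    ((h m).trans (by gcongr; exact le_max_left _ _))

section Basis

variable {ι E : Type*} [Fintype ι] [NormedAddCommGroup E] [InnerProductSpace ℝ E]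
  [FiniteDimensional ℝ E] (B : Module.Basis ι ℝ E)

/-- The vector `½ ∑ kᵢ bᵢ*`, where `(bᵢ*)` is the basis dual to `B` for the inner product. For
`k ∈ ℤ^ι` these are the vectors of the lattice dual to that spanned by `B` with respect to the
bilinear form `2⟨x, y⟩`. -/
noncomputable def dualVec (k : ι → ℤ) : E :=
  (InnerProductSpace.toDual ℝ E).symm
    (LinearMap.toContinuousLinearMap ((1 / 2 : ℝ) • ∑ i, (k i : ℝ) • B.coord i))

lemma two_inner_dualVec (k : ι → ℤ) (v : E) :
    2 * inner ℝ (dualVec B k) v = ∑ i, (k i : ℝ) * B.repr v i := by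
  rw [dualVec, InnerProductSpace.toDual_symm_apply]
  simp

/-- The lattice vector with coordinates `m` in the basis `B`. -/
noncomputable def latVec (m : ι → ℤ) : E := B.equivFun.symm (intVec m)

lemma two_inner_dualVec_latVec (k m : ι → ℤ) :
    2 * inner ℝ (dualVec B k) (latVec B m) = ((∑ i, k i * m i : ℤ) : ℝ) := by
  rw [two_inner_dualVec]
  have : ∀ i, B.repr (latVec B m) i = m i := fun i => by
    rw [← Module.Basis.equivFun_apply, latVec, LinearEquiv.apply_symm_apply, intVec]
  simp [this]

lemma exists_intVec_le_latVec : ∃ K : ℝ, ∀ x : ι → ℝ, ‖x‖ ≤ K * ‖B.equivFun.symm x‖ := by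
  obtain ⟨K, hK⟩ := ((B.equivFun : E ≃ₗ[ℝ] (ι → ℝ)).toLinearMap.toContinuousLinearMap).bound
  refine ⟨K, fun x => ?_⟩
  have h := hK.2 (B.equivFun.symm x)
  rwa [LinearMap.coe_toContinuousLinearMap', LinearEquiv.coe_coe,
    LinearEquiv.apply_symm_apply] at h

lemma exists_intVec_le_dualVec : ∃ K : ℝ, ∀ k : ι → ℤ, ‖intVec k‖ ≤ K * ‖dualVec B k‖ := by
  refine ⟨∑ j, 2 * ‖B j‖, fun k => ?_⟩
  rw [pi_norm_le_iff_of_nonneg (by positivity)]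
  intro j
  have h1 : (k j : ℝ) = 2 * inner ℝ (dualVec B k) (B j) := by
    classical
    rw [two_inner_dualVec]
    simp [Finsupp.single_apply]
  have h2 : ‖intVec k j‖ ≤ 2 * ‖B j‖ * ‖dualVec B k‖ := by
    rw [intVec, h1, norm_mul, Real.norm_ofNat, mul_assoc]
    have := norm_inner_le_norm (𝕜 := ℝ) (dualVec B k) (B j)
    linarith
  refine h2.trans ?_
  gcongr
  exact Finset.single_le_sum (f := fun j => 2 * ‖B j‖) (fun i _ => by positivity)
    (Finset.mem_univ j)

variable [MeasurableSpace E] [BorelSpace E]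

/-- A linear change of variables scales Lebesgue measure by a constant. -/
lemma exists_integral_basis_eq :
    ∃ c : ℝ, ∀ φ : E → ℂ, ∫ x : ι → ℝ, φ (B.equivFun.symm x) = c * ∫ v, φ v := by
  let T : (ι → ℝ) ≃L[ℝ] E := B.equivFun.symm.toContinuousLinearEquiv
  have : (Measure.map T (volume : Measure (ι → ℝ))).IsAddHaarMeasure :=
    T.isAddHaarMeasure_map _
  have h := Measure.isAddLeftInvariant_eq_smul
    (Measure.map T (volume : Measure (ι → ℝ))) (volume : Measure E)
  refine ⟨(Measure.map T (volume : Measure (ι → ℝ))).addHaarScalarFactor volume, fun φ => ?_⟩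
  have h1 := T.toHomeomorph.measurableEmbedding.integral_map (μ := volume) φ
  have h2 : ∫ x : ι → ℝ, φ (B.equivFun.symm x) =
      ∫ v, φ v ∂(Measure.map T (volume : Measure (ι → ℝ))) := h1.symm
  have h3 := congrArg (fun μ => ∫ v, φ v ∂μ) h
  rw [h2]
  refine h3.trans ?_
  rw [integral_smul_nnreal_measure]
  exact Complex.real_smul

/-- Poisson summation for the lattice spanned by a basis `B` of a Euclidean space, shifted by
`ρ`. The constant (the inverse covolume) only depends on `B`. -/
theorem exists_hasSum_poisson_basis : ∃ c : ℝ, ∀ (r C : ℝ) (φ : E → ℂ) (a : (ι → ℤ) → ℂ),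
    (Fintype.card ι : ℝ) < r → Continuous φ → (∀ v, ‖φ v‖ ≤ C * (1 + ‖v‖) ^ (-r)) →
    (∀ k, a k = ∫ v, Complex.exp (-(4 * Real.pi * Complex.I * inner ℝ (dualVec B k) v)) * φ v) →
    Summable a → ∀ ρ : E,
    HasSum (fun k => c * a k *
      Complex.exp (4 * Real.pi * Complex.I * inner ℝ (dualVec B k) ρ))
      (∑' m : ι → ℤ, φ (ρ + latVec B m)) := by
  obtain ⟨c, hc⟩ := exists_integral_basis_eq B
  obtain ⟨K, hK⟩ := exists_intVec_le_latVec B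
  refine ⟨c, fun r C φ a hr hφ hbd ha hsum ρ => ?_⟩
  have hr0 : 0 ≤ r := le_trans (by positivity) hr.le
  have hC : 0 ≤ C := by
    have := (norm_nonneg _).trans (hbd 0)
    simpa using this
  have hcont : Continuous (B.equivFun.symm : (ι → ℝ) → E) :=
    (B.equivFun.symm : (ι → ℝ) ≃ₗ[ℝ] E).toLinearMap.continuous_of_finiteDimensional
  have key : ∀ (k : ι → ℤ) (v : E), 4 * Real.pi * Complex.I * (inner ℝ (dualVec B k) v : ℝ) =
      2 * Real.pi * Complex.I * ∑ i, (k i : ℂ) * (B.equivFun v i : ℝ) := by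
    intro k v
    have h1 := congrArg (fun t : ℝ => (t : ℂ)) (two_inner_dualVec B k v)
    push_cast at h1
    simp only [Module.Basis.equivFun_apply]
    rw [← h1]
    ring
  have h := hasSum_poisson (f := fun x => φ (B.equivFun.symm x)) (C := C * (max K 1) ^ r)
    (c := fun k => c * a k) hr (hφ.comp hcont) ?_ ?_ (hsum.mul_left _) (B.equivFun ρ)
  · have h2 : ∀ m : ι → ℤ, B.equivFun.symm (B.equivFun ρ + intVec m) = ρ + latVec B m := by
      intro m
      rw [map_add, LinearEquiv.symm_apply_apply, latVec]
    simp only [h2] at h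
    simpa only [key] using h
  · intro x
    refine (hbd _).trans ?_
    rw [mul_assoc]
    refine mul_le_mul_of_nonneg_left ?_ hC
    exact rpow_one_add_norm_le_of_norm_le hr0 (le_max_right _ _)
      ((hK x).trans (by gcongr; exact le_max_left _ _))
  · intro k
    rw [ha, ← hc]
    refine integral_congr_ae (Filter.Eventually.of_forall fun x => ?_)
    simp only [key, LinearEquiv.apply_symm_apply]
    congr 2
    simp [mul_assoc]

end Basis

end LatticePoisson

/-! ### Fourier transform of a harmonic quadratic form times a Gaussian -/

section GaussianMoments

open MeasureTheory Set

/-- The quadratic form `∑ Mᵢⱼ xᵢ xⱼ` with real coefficient matrix `M`; it is harmonic exactly when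
`M` has trace `0`. -/
def quadForm {n : ℕ} (M : Matrix (Fin n) (Fin n) ℝ) (x : EuclideanSpace ℝ (Fin n)) : ℝ :=
  ∑ i, ∑ j, M i j * (x i * x j)

section QuadForm

variable {n : ℕ} (M : Matrix (Fin n) (Fin n) ℝ)

lemma quadForm_smul (c : ℝ) (x : EuclideanSpace ℝ (Fin n)) :
    quadForm M (c • x) = c ^ 2 * quadForm M x := by
  simp only [quadForm, Finset.mul_sum, PiLp.smul_apply, smul_eq_mul]
  refine Finset.sum_congr rfl fun i _ => Finset.sum_congr rfl fun j _ => ?_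
  ring

lemma quadForm_zero : quadForm M 0 = 0 := by simp [quadForm]

lemma continuous_quadForm : Continuous (quadForm M) := by
  unfold quadForm
  fun_prop

lemma abs_quadForm_le (x : EuclideanSpace ℝ (Fin n)) :
    |quadForm M x| ≤ (∑ i, ∑ j, |M i j|) * ‖x‖ ^ 2 := by
  rw [quadForm, Finset.sum_mul]
  refine (Finset.abs_sum_le_sum_abs _ _).trans (Finset.sum_le_sum fun i _ => ?_)
  rw [Finset.sum_mul]
  refine (Finset.abs_sum_le_sum_abs _ _).trans (Finset.sum_le_sum fun j _ => ?_)
  rw [abs_mul, abs_mul, sq]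
  have h1 := PiLp.norm_apply_le x i
  have h2 := PiLp.norm_apply_le x j
  rw [Real.norm_eq_abs] at h1 h2
  gcongr

end QuadForm

/-- The Gaussian `exp(2πiw‖v‖²)`. -/
noncomputable def gauss {E : Type*} [NormedAddCommGroup E] (w : ℂ) (v : E) : ℂ :=
  Complex.exp (2 * Real.pi * Complex.I * w * ((‖v‖ ^ 2 : ℝ) : ℂ))

lemma norm_gauss {E : Type*} [NormedAddCommGroup E] (w : ℂ) (v : E) :
    ‖gauss w v‖ = Real.exp (-(2 * Real.pi * w.im) * ‖v‖ ^ 2) := by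
  rw [gauss, Complex.norm_exp]
  congr 1
  rw [Complex.re_mul_ofReal]
  simp [mul_assoc]

lemma continuous_gauss {E : Type*} [NormedAddCommGroup E] (w : ℂ) :
    Continuous (gauss w : E → ℂ) := by
  unfold gauss
  fun_prop

/-- The unitary character `v ↦ exp(-4πi⟨y, v⟩)`, normalized for the bilinear form `2⟨y, v⟩`. -/
noncomputable def phase {n : ℕ} (y v : EuclideanSpace ℝ (Fin n)) : ℂ :=
  Complex.exp (-(4 * Real.pi * Complex.I * inner ℝ y v))

lemma norm_phase {n : ℕ} (y v : EuclideanSpace ℝ (Fin n)) : ‖phase y v‖ = 1 := by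
  rw [phase, show -(4 * Real.pi * Complex.I * inner ℝ y v) =
    ((-(4 * Real.pi * inner ℝ y v) : ℝ) : ℂ) * Complex.I by push_cast; ring]
  exact Complex.norm_exp_ofReal_mul_I _

lemma continuous_phase {n : ℕ} (y : EuclideanSpace ℝ (Fin n)) : Continuous (phase y) := by
  unfold phase
  fun_prop

/-- A bound that is uniform on the half plane `a ≤ Im w`; it gives absolute convergence, locally
uniform convergence and the limit at `i∞` of the theta series. -/
lemma norm_quadForm_mul_gauss_le {n : ℕ} (M : Matrix (Fin n) (Fin n) ℝ) (s : ℕ) {a : ℝ}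
    (ha : 0 < a) : ∃ C : ℝ, ∀ (w : ℂ) (v : EuclideanSpace ℝ (Fin n)), a ≤ w.im →
      ‖(quadForm M v : ℂ) * gauss w v‖ ≤ C * (1 + ‖v‖) ^ (-(s : ℝ)) := by
  refine ⟨(∑ i, ∑ j, |M i j|) * ((2 + s).factorial *
    Real.exp (1 + 1 / (4 * (2 * Real.pi * a)))), fun w v hw => ?_⟩
  have h1 := one_add_pow_mul_exp_le_rpow (a := 2 * Real.pi * a) (by positivity) 2 s (norm_nonneg v)
  rw [norm_mul, Complex.norm_real, Real.norm_eq_abs, norm_gauss]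
  have h0 : 0 ≤ ∑ i, ∑ j, |M i j| := by positivity
  calc |quadForm M v| * Real.exp (-(2 * Real.pi * w.im) * ‖v‖ ^ 2)
      ≤ ((∑ i, ∑ j, |M i j|) * ‖v‖ ^ 2) * Real.exp (-(2 * Real.pi * a) * ‖v‖ ^ 2) := by
        have := abs_quadForm_le M v
        gcongr
    _ ≤ ((∑ i, ∑ j, |M i j|) * (1 + ‖v‖) ^ 2) * Real.exp (-(2 * Real.pi * a) * ‖v‖ ^ 2) := by
        gcongr
        linarith
    _ ≤ _ := by
        simpa only [mul_assoc] using mul_le_mul_of_nonneg_left h1 h0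

section Moments

variable {n : ℕ} {w : ℂ} (y : EuclideanSpace ℝ (Fin n))

lemma integrable_mul_phase_mul_gauss (hw : 0 < w.im) {p : EuclideanSpace ℝ (Fin n) → ℂ}
    (hp : Continuous p) (hb : ∀ v, ‖p v‖ ≤ (1 + ‖v‖) ^ 2) :
    Integrable fun v => p v * (phase y v * gauss w v) := by
  have h := integrable_one_add_norm (E := EuclideanSpace ℝ (Fin n)) (μ := volume)
    (r := ((n + 1 : ℕ) : ℝ)) (by simp)
  refine (h.const_mul ((2 + (n + 1)).factorial *
    Real.exp (1 + 1 / (4 * (2 * Real.pi * w.im))))).mono'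
    (hp.mul ((continuous_phase y).mul (continuous_gauss w))).aestronglyMeasurable
    (Filter.Eventually.of_forall fun v => ?_)
  rw [norm_mul, norm_mul, norm_phase, one_mul, norm_gauss]
  refine le_trans ?_ (one_add_pow_mul_exp_le_rpow (by positivity) 2 (n + 1) (norm_nonneg v))
  have := hb v
  gcongr

lemma hasLineDerivAt_phase_mul_gauss (j : Fin n) (v : EuclideanSpace ℝ (Fin n)) :
    HasLineDerivAt ℝ (fun v => phase y v * gauss w v)
      ((4 * Real.pi * Complex.I * w * v j - 4 * Real.pi * Complex.I * y j) *
        (phase y v * gauss w v)) v (EuclideanSpace.single j 1) := by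
  unfold HasLineDerivAt
  have h1 : ∀ t : ℝ, inner ℝ y (v + t • EuclideanSpace.single j (1 : ℝ)) =
      inner ℝ y v + t * y j := by
    intro t
    simp [inner_add_right, inner_smul_right, EuclideanSpace.inner_single_right]
  have h2 : ∀ t : ℝ, ‖v + t • EuclideanSpace.single j (1 : ℝ)‖ ^ 2 =
      ‖v‖ ^ 2 + 2 * (t * v j) + t ^ 2 := by
    intro t
    rw [norm_add_sq_real]
    simp [inner_smul_right, EuclideanSpace.inner_single_right, norm_smul]
  have h3 : (fun t : ℝ => phase y (v + t • EuclideanSpace.single j (1 : ℝ)) *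
      gauss w (v + t • EuclideanSpace.single j (1 : ℝ))) = fun t : ℝ =>
      Complex.exp (-(4 * Real.pi * Complex.I * (inner ℝ y v + t * y j)) +
        2 * Real.pi * Complex.I * w * ((‖v‖ ^ 2 : ℝ) + 2 * (t * v j) + t ^ 2)) := by
    funext t
    rw [phase, gauss, h1, h2, ← Complex.exp_add]
    push_cast
    rfl
  have h4 : phase y v * gauss w v = Complex.exp (-(4 * Real.pi * Complex.I *
      (inner ℝ y v + (0 : ℝ) * y j)) +
        2 * Real.pi * Complex.I * w * ((‖v‖ ^ 2 : ℝ) + 2 * ((0 : ℝ) * v j) + (0 : ℝ) ^ 2)) := by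
    rw [phase, gauss, ← Complex.exp_add]
    simp
  rw [h3, h4, mul_comm (_ - _)]
  have hid : HasDerivAt (fun t : ℝ => (t : ℂ)) 1 0 := Complex.ofRealCLM.hasDerivAt
  have h5 : HasDerivAt (fun t : ℝ => -(4 * Real.pi * Complex.I * ((inner ℝ y v : ℂ) + t * y j)))
      (-(4 * Real.pi * Complex.I * (1 * y j))) 0 :=
    (((hid.mul_const _).const_add _).const_mul _).neg
  have h6 : HasDerivAt (fun t : ℝ => 2 * Real.pi * Complex.I * w *
      (((‖v‖ ^ 2 : ℝ) : ℂ) + 2 * (t * v j) + (t : ℂ) ^ 2))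
      (2 * Real.pi * Complex.I * w * (2 * (1 * v j) + 2 * ((0 : ℝ) : ℂ) ^ 1 * 1)) 0 := by
    have h7 : HasDerivAt (fun t : ℝ => (t : ℂ) ^ 2) (2 * ((0 : ℝ) : ℂ) ^ 1 * 1) 0 := by
      simpa using hid.fun_pow 2
    exact ((((hid.mul_const _).const_mul _).const_add _).add h7).const_mul _
  refine ((h5.fun_add h6).cexp).congr_deriv ?_
  congr 1
  push_cast
  ring

/-- Integration by parts against the Gaussian times a character: it lowers by one the degree of
the polynomial factor, `p'` being the `j`-th partial derivative of `p`. -/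
lemma integral_parts_phase_mul_gauss (hw : 0 < w.im) (j : Fin n)
    {p p' : EuclideanSpace ℝ (Fin n) → ℂ} (hp : Continuous p) (hp' : Continuous p')
    (hb : ∀ v, ‖p v‖ ≤ 1 + ‖v‖) (hb' : ∀ v, ‖p' v‖ ≤ 1 + ‖v‖)
    (hd : ∀ v, HasLineDerivAt ℝ p (p' v) v (EuclideanSpace.single j 1)) :
    w * ∫ v, (p v * v j) * (phase y v * gauss w v) =
      y j * (∫ v, p v * (phase y v * gauss w v)) -
        (4 * Real.pi * Complex.I)⁻¹ * ∫ v, p' v * (phase y v * gauss w v) := by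
  have hsq : ∀ v : EuclideanSpace ℝ (Fin n), 1 + ‖v‖ ≤ (1 + ‖v‖) ^ 2 := fun v => by
    nlinarith [norm_nonneg v]
  have hpi : (4 * Real.pi * Complex.I : ℂ) ≠ 0 := by
    simp [Real.pi_ne_zero]
  have i1 := integrable_mul_phase_mul_gauss y hw hp fun v => (hb v).trans (hsq v)
  have i2 := integrable_mul_phase_mul_gauss y hw hp' fun v => (hb' v).trans (hsq v)
  have i3 : Integrable fun v => (p v * v j) * (phase y v * gauss w v) := by
    refine integrable_mul_phase_mul_gauss y hw (hp.mul (by fun_prop)) fun v => ?_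
    rw [norm_mul, sq, Complex.norm_real]
    have := PiLp.norm_apply_le v j
    have := hb v
    gcongr
    linarith [norm_nonneg v]
  have h := integral_bilinear_hasLineDerivAt_right_eq_neg_left_of_integrable
    (μ := (volume : Measure (EuclideanSpace ℝ (Fin n)))) (B := ContinuousLinearMap.mul ℝ ℂ)
    (f := p) (f' := p') (v := EuclideanSpace.single j 1) (by simpa using i2) (by
      simp only [ContinuousLinearMap.mul_apply']
      have := (i3.const_mul (4 * Real.pi * Complex.I * w)).sub
        (i1.const_mul (4 * Real.pi * Complex.I * y j))
      refine this.congr (Filter.Eventually.of_forall fun v => ?_)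
      simp only [Pi.sub_apply]
      ring) (by simpa using i1) (fun v _ => hd v)
    (fun v _ => hasLineDerivAt_phase_mul_gauss (w := w) y j v)
  simp only [ContinuousLinearMap.mul_apply'] at h
  have h2 : ∫ v, p v * ((4 * Real.pi * Complex.I * w * v j - 4 * Real.pi * Complex.I * y j) *
      (phase y v * gauss w v)) = (4 * Real.pi * Complex.I * w) *
        (∫ v, (p v * v j) * (phase y v * gauss w v)) -
        (4 * Real.pi * Complex.I * y j) * ∫ v, p v * (phase y v * gauss w v) := by
    rw [← integral_const_mul, ← integral_const_mul, ← integral_sub (i3.const_mul _)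
      (i1.const_mul _)]
    congr 1
    funext v
    ring
  rw [h2] at h
  have h3 : (∫ v, p' v * (phase y v * gauss w v)) = 4 * Real.pi * Complex.I *
    (y j * (∫ v, p v * (phase y v * gauss w v)) -
      w * ∫ v, (p v * v j) * (phase y v * gauss w v)) := by
    linear_combination h
  rw [h3, inv_mul_cancel_left₀ hpi]
  ring

/-- The factor `(i / 2w)^{n/2}` of the Gaussian integral in dimension `n`, with the principal
branch of the power. Only its square `(i / 2w)^n` matters for squares of theta series. -/
noncomputable def gaussFactor (n : ℕ) (w : ℂ) : ℂ :=
  (Real.pi / (-(2 * Real.pi * Complex.I * w))) ^ (n / 2 : ℂ)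

lemma gaussFactor_sq (n : ℕ) (w : ℂ) : gaussFactor n w ^ 2 = (Complex.I / (2 * w)) ^ n := by
  rw [gaussFactor, ← Complex.cpow_nat_mul,
    show ((2 : ℕ) : ℂ) * (n / 2 : ℂ) = n by push_cast; ring, Complex.cpow_natCast]
  congr 1
  have hpi : (Real.pi : ℂ) ≠ 0 := by simp [Real.pi_ne_zero]
  rcases eq_or_ne w 0 with rfl | hw
  · simp
  · have hI := Complex.I_ne_zero
    field_simp
    simp

lemma integral_phase_mul_gauss (hw : 0 < w.im) :
    ∫ v, phase y v * gauss w v = gaussFactor n w * gauss (-1 / w) y := by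
  have hw0 : w ≠ 0 := by rintro rfl; simp at hw
  have hb : 0 < (-(2 * Real.pi * Complex.I * w)).re := by
    simp
    positivity
  have h := GaussianFourier.integral_cexp_neg_mul_sq_norm_add hb (-(4 * Real.pi * Complex.I)) y
  rw [finrank_euclideanSpace_fin] at h
  have h2 : ∀ v : EuclideanSpace ℝ (Fin n), phase y v * gauss w v =
      Complex.exp (-(-(2 * Real.pi * Complex.I * w)) * ‖v‖ ^ 2 +
        -(4 * Real.pi * Complex.I) * inner ℝ y v) := by
    intro v
    rw [phase, gauss, ← Complex.exp_add]
    congr 1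
    push_cast
    ring
  simp only [h2]
  rw [h, gaussFactor, gauss]
  congr 2
  have hpi : (Real.pi : ℂ) ≠ 0 := by simp [Real.pi_ne_zero]
  have hI := Complex.I_ne_zero
  push_cast
  field_simp
  ring

/-- The Fourier transform of a harmonic quadratic form times a Gaussian is of the same shape:
the trace term from the second moments vanishes. -/
lemma integral_phase_mul_quadForm_mul_gauss (hw : 0 < w.im) {M : Matrix (Fin n) (Fin n) ℝ}
    (hM : M.trace = 0) :
    ∫ v, phase y v * (quadForm M v * gauss w v) =
      gaussFactor n w * w⁻¹ ^ 2 * (quadForm M y * gauss (-1 / w) y) := by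
  have hw0 : w ≠ 0 := by rintro rfl; simp at hw
  set I0 := ∫ v, phase y v * gauss w v with hI0
  have hone : ∀ v : EuclideanSpace ℝ (Fin n), ‖(1 : ℂ)‖ ≤ 1 + ‖v‖ := fun v => by simp
  have hzero : ∀ v : EuclideanSpace ℝ (Fin n), ‖(0 : ℂ)‖ ≤ 1 + ‖v‖ := fun v => by
    simp
    positivity
  have m1 : ∀ j, ∫ v : EuclideanSpace ℝ (Fin n), (v j : ℂ) * (phase y v * gauss w v) =
      w⁻¹ * (y j * I0) := by
    intro j
    have := integral_parts_phase_mul_gauss y hw j (p := fun _ => 1) (p' := fun _ => 0)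
      continuous_const continuous_const hone hzero
      (fun v => hasDerivAt_const (0 : ℝ) (1 : ℂ))
    simp only [one_mul, zero_mul, integral_zero, mul_zero, sub_zero] at this
    rw [hI0, ← this, inv_mul_cancel_left₀ hw0]
  have m2 : ∀ i j, ∫ v : EuclideanSpace ℝ (Fin n), ((v i : ℂ) * v j) * (phase y v * gauss w v) =
      w⁻¹ ^ 2 * (y i * y j * I0) -
        if i = j then w⁻¹ * ((4 * Real.pi * Complex.I)⁻¹ * I0) else 0 := by
    intro i j
    have := integral_parts_phase_mul_gauss y hw j (p := fun v => (v i : ℂ))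
      (p' := fun _ => if i = j then 1 else 0) (by fun_prop) continuous_const
      (fun v => by
        rw [Complex.norm_real]
        linarith [PiLp.norm_apply_le v i])
      (fun v => by
        split_ifs
        · exact hone v
        · exact hzero v)
      (fun v => by
        unfold HasLineDerivAt
        have hid : HasDerivAt (fun t : ℝ => (t : ℂ)) 1 0 := Complex.ofRealCLM.hasDerivAt
        have h3 := (hid.mul_const (if i = j then (1 : ℂ) else 0)).const_add (v i : ℂ)
        rw [one_mul] at h3
        convert h3 using 1
        funext t
        split_ifs <;> simp [*])
    rw [m1] at this
    have h4 : (∫ v, (if i = j then (1 : ℂ) else 0) * (phase y v * gauss w v)) =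
        if i = j then I0 else 0 := by
      split_ifs <;> simp [hI0]
    rw [h4] at this
    apply mul_left_cancel₀ hw0
    rw [this]
    split_ifs
    · field_simp
    · rw [mul_zero, sub_zero, sub_zero]
      field_simp
  have i3 : ∀ i j, Integrable fun v : EuclideanSpace ℝ (Fin n) =>
      ((v i : ℂ) * v j) * (phase y v * gauss w v) := fun i j => by
    refine integrable_mul_phase_mul_gauss y hw (by fun_prop) fun v => ?_
    rw [norm_mul, sq, Complex.norm_real, Complex.norm_real]
    have := PiLp.norm_apply_le v j
    have := PiLp.norm_apply_le v i
    gcongr <;> linarith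
  have h5 : ∀ v : EuclideanSpace ℝ (Fin n), phase y v * (quadForm M v * gauss w v) =
      ∑ i, ∑ j, (M i j : ℂ) * (((v i : ℂ) * v j) * (phase y v * gauss w v)) := by
    intro v
    rw [quadForm]
    push_cast
    rw [mul_left_comm, Finset.sum_mul]
    refine Finset.sum_congr rfl fun i _ => ?_
    rw [Finset.sum_mul]
    refine Finset.sum_congr rfl fun j _ => ?_
    ring
  simp only [h5]
  rw [integral_finsetSum _ fun i _ => integrable_finsetSum _ fun j _ => (i3 i j).const_mul _]
  have h6 : ∀ i, ∫ v : EuclideanSpace ℝ (Fin n),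
      ∑ j, (M i j : ℂ) * (((v i : ℂ) * v j) * (phase y v * gauss w v)) =
      (∑ j, (M i j : ℂ) * (w⁻¹ ^ 2 * (y i * y j * I0))) -
        (M i i : ℂ) * (w⁻¹ * ((4 * Real.pi * Complex.I)⁻¹ * I0)) := by
    intro i
    rw [integral_finsetSum _ fun j _ => (i3 i j).const_mul _]
    simp only [integral_const_mul, m2, mul_sub, Finset.sum_sub_distrib]
    congr 1
    simp
  simp only [h6, Finset.sum_sub_distrib]
  have h7 : ∑ i, (M i i : ℂ) * (w⁻¹ * ((4 * Real.pi * Complex.I)⁻¹ * I0)) = 0 := by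
    rw [← Finset.sum_mul]
    have : (∑ i, (M i i : ℂ)) = ((M.trace : ℝ) : ℂ) := by
      rw [Matrix.trace]
      push_cast
      rfl
    rw [this, hM]
    simp
  rw [h7, sub_zero, hI0, integral_phase_mul_gauss y hw, quadForm]
  push_cast
  simp only [Finset.mul_sum, Finset.sum_mul]
  refine Finset.sum_congr rfl fun i _ => Finset.sum_congr rfl fun j _ => ?_
  ring

end Moments

end GaussianMoments

/-! ### Theta inversion and expansion at rational points -/

section ThetaInversion

open MeasureTheory Set

/-- The additive character `e(x) = exp(2πix)` of `ℝ`. -/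
noncomputable def eChar (x : ℝ) : ℂ := Complex.exp (2 * Real.pi * Complex.I * x)

lemma eChar_add (x y : ℝ) : eChar (x + y) = eChar x * eChar y := by
  rw [eChar, eChar, eChar, ← Complex.exp_add]
  push_cast
  ring_nf

lemma eChar_zero : eChar 0 = 1 := by simp [eChar]

lemma eChar_int (m : ℤ) : eChar m = 1 := by
  rw [eChar, Complex.exp_eq_one_iff]
  exact ⟨m, by push_cast; ring⟩

lemma eChar_add_int (x : ℝ) (m : ℤ) : eChar (x + m) = eChar x := by
  rw [eChar_add, eChar_int, mul_one]

lemma norm_eChar (x : ℝ) : ‖eChar x‖ = 1 := by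
  rw [eChar, show 2 * (Real.pi : ℂ) * Complex.I * x = ((2 * Real.pi * x : ℝ) : ℂ) * Complex.I by
    push_cast; ring]
  exact Complex.norm_exp_ofReal_mul_I _

lemma gauss_add_real {E : Type*} [NormedAddCommGroup E] (t : ℝ) (w : ℂ) (v : E) :
    gauss (t + w) v = eChar (t * ‖v‖ ^ 2) * gauss w v := by
  rw [gauss, gauss, eChar, ← Complex.exp_add]
  congr 1
  push_cast
  ring

lemma gauss_smul {E : Type*} [NormedAddCommGroup E] [NormedSpace ℝ E] (w : ℂ) (t : ℝ) (v : E) :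
    gauss w (t • v) = gauss (t ^ 2 * w) v := by
  rw [gauss, gauss, norm_smul, mul_pow, Real.norm_eq_abs, sq_abs]
  congr 1
  push_cast
  ring

section Lattice

variable {n : ℕ} (Λ : Submodule ℤ (EuclideanSpace ℝ (Fin n)))

lemma dual_add {y y' : EuclideanSpace ℝ (Fin n)} (hy : y ∈ dual Λ) (hy' : y' ∈ dual Λ) :
    y + y' ∈ dual Λ := by
  intro x hx
  obtain ⟨m, hm⟩ := hy x hx
  obtain ⟨m', hm'⟩ := hy' x hx
  refine ⟨m + m', ?_⟩
  rw [inner_add_right, mul_add, hm, hm']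
  push_cast
  rfl

/-- In an integral lattice `2⟨x, y⟩` is an integer, so the lattice lies in its dual. -/
lemma mem_dual_of_isIntegral {Λ : Submodule ℤ (EuclideanSpace ℝ (Fin n))} (hΛ : IsIntegral Λ)
    {x : EuclideanSpace ℝ (Fin n)} (hx : x ∈ Λ) : x ∈ dual Λ := by
  intro y hy
  obtain ⟨a, ha⟩ := hΛ _ (Λ.add_mem hy hx)
  obtain ⟨b, hb⟩ := hΛ _ hx
  obtain ⟨c, hc⟩ := hΛ _ hy
  refine ⟨a - b - c, ?_⟩
  rw [norm_add_sq_real, hb, hc] at ha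
  push_cast
  linarith

end Lattice

section Reduction

variable {n : ℕ} {Λ : Submodule ℤ (EuclideanSpace ℝ (Fin n))}
  (b : Module.Basis (Fin n) ℤ Λ)

/-- Representatives of `Λ / mΛ`, indexed by their coordinates modulo `m`. -/
noncomputable def rep (m : ℕ) (q : Fin n → ZMod m) : Λ :=
  b.equivFun.symm fun i => ((q i).val : ℤ)

/-- Reduction `Λ → Λ / mΛ`, in coordinates. -/
noncomputable def red (m : ℕ) : Λ →+ (Fin n → ZMod m) where
  toFun x i := (b.equivFun x i : ZMod m)
  map_zero' := by ext i; simp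
  map_add' x y := by
    ext i
    rw [map_add, Pi.add_apply, Pi.add_apply, Int.cast_add]

variable (m : ℕ)

lemma red_eq_zero_iff (x : Λ) : red b m x = 0 ↔ ∃ γ : Λ, x = (m : ℤ) • γ := by
  constructor
  · intro h
    have h1 : ∀ i, ∃ t, b.equivFun x i = m * t := fun i =>
      (ZMod.intCast_zmod_eq_zero_iff_dvd _ m).mp (congrFun h i)
    choose t ht using h1
    refine ⟨b.equivFun.symm t, ?_⟩
    apply b.equivFun.injective
    rw [map_smul, LinearEquiv.apply_symm_apply]
    ext i
    rw [ht, Pi.smul_apply, smul_eq_mul]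
  · rintro ⟨γ, rfl⟩
    ext i
    change ((b.equivFun ((m : ℤ) • γ) i : ℤ) : ZMod m) = 0
    rw [map_smul, Pi.smul_apply, smul_eq_mul]
    simp

variable [NeZero m]

lemma red_rep (q : Fin n → ZMod m) : red b m (rep b m q) = q := by
  ext i
  change ((b.equivFun (b.equivFun.symm _) i : ℤ) : ZMod m) = _
  rw [LinearEquiv.apply_symm_apply]
  simp

lemma exists_eq_rep_add (x : Λ) : ∃ γ : Λ, x = rep b m (red b m x) + (m : ℤ) • γ := by
  obtain ⟨γ, hγ⟩ := (red_eq_zero_iff b m (x - rep b m (red b m x))).mp (by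
    rw [map_sub, red_rep, sub_self])
  exact ⟨γ, by rw [← hγ]; abel⟩

/-- Every lattice vector is uniquely a representative modulo `m` plus `m` times a lattice
vector. -/
noncomputable def repEquiv : (Fin n → ZMod m) × Λ ≃ Λ :=
  Equiv.ofBijective (fun p => rep b m p.1 + (m : ℤ) • p.2) (by
    constructor
    · rintro ⟨q, γ⟩ ⟨q', γ'⟩ h
      simp only at h
      have h0 : ∀ γ : Λ, red b m ((m : ℤ) • γ) = 0 := fun γ =>
        (red_eq_zero_iff b m _).mpr ⟨γ, rfl⟩
      have h1 := congrArg (red b m) h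
      rw [map_add, map_add, h0, h0, red_rep, red_rep, add_zero, add_zero] at h1
      subst h1
      have h2 := add_left_cancel h
      have h3 : γ = γ' := by
        apply b.equivFun.injective
        have h4 := congrArg b.equivFun h2
        rw [map_smul, map_smul] at h4
        exact smul_right_injective _ (by exact_mod_cast NeZero.ne m) h4
      rw [h3]
    · intro x
      obtain ⟨γ, hγ⟩ := exists_eq_rep_add b m x
      exact ⟨(red b m x, γ), hγ.symm⟩)

/-- The sum over `Λ / mΛ` of a function on `Λ` that is invariant under `mΛ`. -/
noncomputable def repSum (Φ : Λ → ℂ) : ℂ := ∑ q : Fin n → ZMod m, Φ (rep b m q)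

variable {m} in
lemma eq_rep_red {Φ : Λ → ℂ} (hΦ : ∀ x γ : Λ, Φ (x + (m : ℤ) • γ) = Φ x) (x : Λ) :
    Φ (rep b m (red b m x)) = Φ x := by
  obtain ⟨γ, hγ⟩ := exists_eq_rep_add b m x
  conv_rhs => rw [hγ]
  exact (hΦ _ _).symm

lemma repSum_add {Φ : Λ → ℂ} (hΦ : ∀ x γ : Λ, Φ (x + (m : ℤ) • γ) = Φ x) (x : Λ) :
    repSum b m (fun z => Φ (z + x)) = repSum b m Φ := by
  rw [repSum, repSum, ← Equiv.sum_comp (Equiv.addRight (red b m x)) (fun q => Φ (rep b m q))]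
  refine Finset.sum_congr rfl fun q _ => ?_
  rw [← eq_rep_red b hΦ (rep b m q + x), map_add, red_rep]
  rfl

/-- The Gauss sum `∑_{ρ ∈ Λ/mΛ} e((a‖ρ‖² + 2⟨y, ρ⟩) / m)`. -/
noncomputable def latGauss (a : ℤ) (y : EuclideanSpace ℝ (Fin n)) : ℂ :=
  repSum b m fun ρ => eChar ((a * ‖(ρ : EuclideanSpace ℝ (Fin n))‖ ^ 2 + 2 * inner ℝ y ρ) / m)

/-- The terms of the Gauss sum only depend on the class modulo `m` (for `y` in the dual), so that
`latGauss` does not depend on the choice of representatives. -/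
lemma latGauss_term_periodic (hΛ : IsIntegral Λ) (a : ℤ) {y : EuclideanSpace ℝ (Fin n)}
    (hy : y ∈ dual Λ) (x γ : Λ) :
    eChar ((a * ‖((x + (m : ℤ) • γ : Λ) : EuclideanSpace ℝ (Fin n))‖ ^ 2 +
      2 * inner ℝ y (x + (m : ℤ) • γ : Λ)) / m) =
    eChar ((a * ‖(x : EuclideanSpace ℝ (Fin n))‖ ^ 2 + 2 * inner ℝ y x) / m) := by
  obtain ⟨s, hs⟩ := hΛ γ γ.2
  obtain ⟨t, ht⟩ := mem_dual_of_isIntegral hΛ γ.2 x x.2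
  obtain ⟨r, hr⟩ := hy γ γ.2
  have hm : (m : ℝ) ≠ 0 := by exact_mod_cast NeZero.ne m
  have h1 : (((x + (m : ℤ) • γ : Λ)) : EuclideanSpace ℝ (Fin n)) =
      (x : EuclideanSpace ℝ (Fin n)) + (m : ℝ) • (γ : EuclideanSpace ℝ (Fin n)) := by
    rw [Submodule.coe_add, Submodule.coe_smul, ← Int.cast_smul_eq_zsmul ℝ]
    simp
  refine Eq.trans ?_ (eChar_add_int _ (a * t + a * m * s + r))
  rw [h1, norm_add_sq_real, inner_add_right, inner_smul_right,
    inner_smul_right, norm_smul, mul_pow, hs, Real.norm_eq_abs, sq_abs]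
  rw [real_inner_comm] at hr
  congr 1
  push_cast
  rw [← ht, ← hr]
  field_simp
  ring

lemma norm_latGauss_le (a : ℤ) (y : EuclideanSpace ℝ (Fin n)) :
    ‖latGauss b m a y‖ ≤ Fintype.card (Fin n → ZMod m) := by
  refine (norm_sum_le _ _).trans ?_
  simp [norm_eChar]

end Reduction

section ZLattice

variable {n : ℕ} (Λ : Submodule ℤ (EuclideanSpace ℝ (Fin n)))
variable [DiscreteTopology Λ] [IsZLattice ℝ Λ]

lemma exists_latticeBasis : Nonempty (Module.Basis (Fin n) ℤ Λ) := by
  have : Module.Finite ℤ Λ := ZLattice.module_finite ℝ Λ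
  have : Module.Free ℤ Λ := ZLattice.module_free ℝ Λ
  have h : Module.finrank ℤ Λ = n := by
    rw [ZLattice.rank ℝ Λ, finrank_euclideanSpace_fin]
  exact ⟨(Module.finBasisOfFinrankEq ℤ Λ h)⟩

variable {Λ}
variable (b : Module.Basis (Fin n) ℤ Λ)

lemma latVec_ofZLatticeBasis (m : Fin n → ℤ) :
    latVec (b.ofZLatticeBasis ℝ Λ) m = (b.equivFun.symm m : Λ) := by
  rw [latVec, Module.Basis.equivFun_symm_apply, Module.Basis.equivFun_symm_apply]
  simp [intVec, Int.cast_smul_eq_zsmul]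

/-- The dual lattice vector with coordinates `k` in half the basis dual to `b`. -/
noncomputable def dualLatVec (k : Fin n → ℤ) : EuclideanSpace ℝ (Fin n) :=
  dualVec (b.ofZLatticeBasis ℝ Λ) k

lemma dualLatVec_mem (k : Fin n → ℤ) : dualLatVec b k ∈ dual Λ := by
  intro x hx
  refine ⟨∑ i, k i * b.equivFun ⟨x, hx⟩ i, ?_⟩
  have h := two_inner_dualVec_latVec (b.ofZLatticeBasis ℝ Λ) k (b.equivFun ⟨x, hx⟩)
  rw [latVec_ofZLatticeBasis, LinearEquiv.symm_apply_apply] at h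
  rw [real_inner_comm]
  exact h

/-- An integer `N` with `N‖y‖² ∈ ℤ` on the dual lattice maps the dual into the lattice: by
polarization `2⟨z, Ny⟩` is an integer for all `z` in the dual, in particular for the vectors of
the dual basis. -/
lemma smul_dual_mem {N : ℤ} (hN : ∀ y ∈ dual Λ, ∃ m : ℤ, (N : ℝ) * ‖y‖ ^ 2 = m)
    {y : EuclideanSpace ℝ (Fin n)} (hy : y ∈ dual Λ) : N • y ∈ Λ := by
  obtain ⟨b⟩ := exists_latticeBasis Λ
  set B := b.ofZLatticeBasis ℝ Λ with hB
  have hcoord : ∀ i, ∃ m : ℤ, B.repr (N • y) i = m := by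
    intro i
    set z := dualLatVec b (Pi.single i 1) with hz
    have hzd : z ∈ dual Λ := dualLatVec_mem b _
    obtain ⟨p, hp⟩ := hN _ (dual_add Λ hzd hy)
    obtain ⟨q, hq⟩ := hN _ hzd
    obtain ⟨r, hr⟩ := hN _ hy
    refine ⟨p - q - r, ?_⟩
    have h1 := two_inner_dualVec B (Pi.single i 1) (N • y)
    have h2 : ∑ j, (((Pi.single i 1 : Fin n → ℤ) j : ℤ) : ℝ) * B.repr (N • y) j =
        B.repr (N • y) i := by
      simp [Pi.single_apply]
    rw [h2] at h1
    rw [← h1, ← Int.cast_smul_eq_zsmul ℝ N y, inner_smul_right]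
    rw [norm_add_sq_real, mul_add, mul_add, hq, hr] at hp
    push_cast
    have h3 : inner ℝ (dualVec B (Pi.single i 1)) y = inner ℝ z y := rfl
    rw [h3]
    linarith
  choose m hm using hcoord
  have : N • y = latVec B m := by
    rw [latVec, LinearEquiv.eq_symm_apply]
    ext i
    rw [Module.Basis.equivFun_apply, hm, intVec]
  rw [this, latVec_ofZLatticeBasis]
  exact Subtype.coe_prop _

lemma summable_one_add_norm_dualLatVec :
    Summable fun k => (1 + ‖dualLatVec b k‖) ^ (-((n + 1 : ℕ) : ℝ)) := by
  obtain ⟨K, hK⟩ := exists_intVec_le_dualVec (b.ofZLatticeBasis ℝ Λ)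
  exact summable_of_intVec_le (by simp) hK

lemma summable_one_add_norm_lattice :
    Summable fun γ : Λ => (1 + ‖(γ : EuclideanSpace ℝ (Fin n))‖) ^ (-((n + 1 : ℕ) : ℝ)) := by
  obtain ⟨b⟩ := exists_latticeBasis Λ
  obtain ⟨K, hK⟩ := exists_intVec_le_latVec (b.ofZLatticeBasis ℝ Λ)
  rw [← b.equivFun.symm.toEquiv.summable_iff]
  refine (summable_of_intVec_le (r := ((n + 1 : ℕ) : ℝ)) (by simp)
    (v := latVec (b.ofZLatticeBasis ℝ Λ)) fun m => hK (intVec m)).congr fun m => ?_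
  rw [latVec_ofZLatticeBasis]
  rfl

lemma summable_quadForm_mul_gauss (M : Matrix (Fin n) (Fin n) ℝ) {w : ℂ} (hw : 0 < w.im) :
    Summable fun γ : Λ => (quadForm M γ : ℂ) * gauss w (γ : EuclideanSpace ℝ (Fin n)) := by
  obtain ⟨C, hC⟩ := norm_quadForm_mul_gauss_le M (n + 1) hw
  exact Summable.of_norm_bounded (summable_one_add_norm_lattice.mul_left C)
    fun γ => hC w γ le_rfl

lemma summable_quadForm_mul_gauss_dual (M : Matrix (Fin n) (Fin n) ℝ) {w : ℂ} (hw : 0 < w.im) :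
    Summable fun k => (quadForm M (dualLatVec b k) : ℂ) * gauss w (dualLatVec b k) := by
  obtain ⟨C, hC⟩ := norm_quadForm_mul_gauss_le M (n + 1) hw
  exact Summable.of_norm_bounded ((summable_one_add_norm_dualLatVec b).mul_left C)
    fun γ => hC w _ le_rfl

lemma neg_one_div_im_pos {w : ℂ} (hw : 0 < w.im) : 0 < (-1 / w).im := by
  have hw0 : w ≠ 0 := by rintro rfl; simp at hw
  rw [neg_div, one_div, Complex.neg_im, Complex.inv_im, neg_div, neg_neg]
  exact div_pos hw (Complex.normSq_pos.mpr hw0)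

/-- Inversion formula for the theta series of a shifted lattice with a harmonic quadratic form. -/
theorem exists_theta_inversion : ∃ c : ℂ, ∀ (M : Matrix (Fin n) (Fin n) ℝ) (w : ℂ)
    (ρ : EuclideanSpace ℝ (Fin n)), M.trace = 0 → 0 < w.im →
    HasSum (fun γ : Λ => (quadForm M (ρ + γ) : ℂ) * gauss w (ρ + γ))
      (c * gaussFactor n w * w⁻¹ ^ 2 *
        ∑' k, (quadForm M (dualLatVec b k) * gauss (-1 / w) (dualLatVec b k)) *
          eChar (2 * inner ℝ (dualLatVec b k) ρ)) := by
  obtain ⟨c, hc⟩ := exists_hasSum_poisson_basis (b.ofZLatticeBasis ℝ Λ)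
  refine ⟨c, fun M w ρ hM hw => ?_⟩
  obtain ⟨C, hC⟩ := norm_quadForm_mul_gauss_le M (n + 1) hw
  have hsum := summable_quadForm_mul_gauss_dual b M (neg_one_div_im_pos hw)
  have h := hc ((n + 1 : ℕ) : ℝ) C (fun v => (quadForm M v : ℂ) * gauss w v)
    (fun k => gaussFactor n w * w⁻¹ ^ 2 *
      (quadForm M (dualLatVec b k) * gauss (-1 / w) (dualLatVec b k)))
    (by simp)
    ((Complex.continuous_ofReal.comp (continuous_quadForm M)).mul (continuous_gauss w))
    (fun v => hC w v le_rfl)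
    (fun k => (integral_phase_mul_quadForm_mul_gauss (dualLatVec b k) hw hM).symm)
    (hsum.mul_left _) ρ
  have hs : Summable fun γ : Λ => (quadForm M (ρ + γ) : ℂ) * gauss w (ρ + γ) := by
    have hC0 : 0 ≤ C := by
      have := (norm_nonneg _).trans (hC w 0 le_rfl)
      simpa using this
    refine Summable.of_norm_bounded (g := fun γ : Λ => C * ((1 + ‖ρ‖) ^ ((n + 1 : ℕ) : ℝ) *
      (1 + ‖(γ : EuclideanSpace ℝ (Fin n))‖) ^ (-((n + 1 : ℕ) : ℝ))))
      ((summable_one_add_norm_lattice.mul_left _).mul_left C) fun γ => (hC w _ le_rfl).trans ?_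
    exact mul_le_mul_of_nonneg_left
      (rpow_one_add_norm_add_le (by positivity) le_rfl) hC0
  have h1 : ∑' m : Fin n → ℤ, (quadForm M (ρ + latVec (b.ofZLatticeBasis ℝ Λ) m) : ℂ) *
      gauss w (ρ + latVec (b.ofZLatticeBasis ℝ Λ) m) =
      ∑' γ : Λ, (quadForm M (ρ + γ) : ℂ) * gauss w (ρ + γ) := by
    rw [← b.equivFun.symm.toEquiv.tsum_eq
      fun γ : Λ => (quadForm M (ρ + γ) : ℂ) * gauss w (ρ + γ)]
    refine tsum_congr fun m => ?_
    rw [latVec_ofZLatticeBasis]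
    rfl
  rw [h1] at h
  convert hs.hasSum using 1
  rw [← h.tsum_eq, ← tsum_mul_left]
  refine tsum_congr fun k => ?_
  have h2 : Complex.exp (4 * Real.pi * Complex.I *
      (inner ℝ (dualVec (b.ofZLatticeBasis ℝ Λ) k) ρ : ℝ)) =
      eChar (2 * inner ℝ (dualLatVec b k) ρ) := by
    rw [eChar, dualLatVec]
    congr 1
    push_cast
    ring
  rw [h2]
  ring

/-- Expansion of the theta series around the rational point `a / m`, together with the inversion
formula for the same constant `c`. -/
theorem exists_theta_expansion_at_rational (hΛ : IsIntegral Λ) :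
    ∃ c : ℂ, (∀ (M : Matrix (Fin n) (Fin n) ℝ) (w : ℂ), M.trace = 0 → 0 < w.im →
      ∑' γ : Λ, (quadForm M γ : ℂ) * gauss w (γ : EuclideanSpace ℝ (Fin n)) =
        c * gaussFactor n w * w⁻¹ ^ 2 *
          ∑' k, quadForm M (dualLatVec b k) * gauss (-1 / w) (dualLatVec b k)) ∧
    ∀ (m : ℕ) [NeZero m] (a : ℤ) (M : Matrix (Fin n) (Fin n) ℝ) (u : ℂ),
    M.trace = 0 → 0 < u.im →
    ∑' γ : Λ, (quadForm M γ : ℂ) * gauss ((a / m : ℝ) + u) (γ : EuclideanSpace ℝ (Fin n)) =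
      (m : ℂ) ^ 2 * (c * gaussFactor n ((m : ℂ) ^ 2 * u) * ((m : ℂ) ^ 2 * u)⁻¹ ^ 2) *
        ∑' k, (quadForm M (dualLatVec b k) * gauss (-1 / ((m : ℂ) ^ 2 * u)) (dualLatVec b k)) *
          latGauss b m a (dualLatVec b k) := by
  obtain ⟨c, hc⟩ := exists_theta_inversion b
  refine ⟨c, fun M w hM hw => ?_, fun m _ a M u hM hu => ?_⟩
  · have h := (hc M w 0 hM hw).tsum_eq
    simpa only [zero_add, inner_zero_right, mul_zero, eChar_zero, mul_one] using h
  have hm0 : (m : ℝ) ≠ 0 := by exact_mod_cast NeZero.ne m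
  have hmu : 0 < ((m : ℂ) ^ 2 * u).im := by
    rw [show (m : ℂ) ^ 2 = ((m ^ 2 : ℝ) : ℂ) by push_cast; rfl, Complex.im_ofReal_mul]
    positivity
  have hau : 0 < (((a / m : ℝ) : ℂ) + u).im := by
    rw [Complex.add_im, Complex.ofReal_im, zero_add]
    exact hu
  have hs := summable_quadForm_mul_gauss (Λ := Λ) M hau
  rw [← (repEquiv b m).tsum_eq]
  have hs' := (repEquiv b m).summable_iff.mpr hs
  rw [Summable.tsum_prod (by exact hs'), tsum_fintype]
  -- the class of `ρ` modulo `m` contributes the theta series of the lattice shifted by `ρ / m`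
  have key : ∀ (q : Fin n → ZMod m), ∑' γ : Λ, (quadForm M (repEquiv b m (q, γ)) : ℂ) *
      gauss ((a / m : ℝ) + u) (repEquiv b m (q, γ) : EuclideanSpace ℝ (Fin n)) =
      (m : ℂ) ^ 2 * (c * gaussFactor n ((m : ℂ) ^ 2 * u) * ((m : ℂ) ^ 2 * u)⁻¹ ^ 2) *
        ∑' k, (quadForm M (dualLatVec b k) * gauss (-1 / ((m : ℂ) ^ 2 * u)) (dualLatVec b k)) *
          eChar ((a * ‖(rep b m q : EuclideanSpace ℝ (Fin n))‖ ^ 2 +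
            2 * inner ℝ (dualLatVec b k) (rep b m q)) / m) := by
    intro q
    set ρ : EuclideanSpace ℝ (Fin n) := (rep b m q).1 with hρ
    have h := (hc M ((m : ℂ) ^ 2 * u) ((m : ℝ)⁻¹ • ρ) hM hmu).tsum_eq
    have hterm : ∀ γ : Λ, (quadForm M (repEquiv b m (q, γ)) : ℂ) *
        gauss ((a / m : ℝ) + u) (repEquiv b m (q, γ) : EuclideanSpace ℝ (Fin n)) =
        (m : ℂ) ^ 2 * eChar (a * ‖ρ‖ ^ 2 / m) *
          ((quadForm M ((m : ℝ)⁻¹ • ρ + γ) : ℂ) *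
            gauss ((m : ℂ) ^ 2 * u) ((m : ℝ)⁻¹ • ρ + γ)) := by
      intro γ
      have h1 : (repEquiv b m (q, γ) : EuclideanSpace ℝ (Fin n)) =
          (m : ℝ) • ((m : ℝ)⁻¹ • ρ + γ) := by
        change ((rep b m q + (m : ℤ) • γ : Λ) : EuclideanSpace ℝ (Fin n)) = _
        rw [Submodule.coe_add, Submodule.coe_smul, ← Int.cast_smul_eq_zsmul ℝ, smul_add,
          smul_inv_smul₀ hm0, ← hρ]
        simp
      have h2 := latGauss_term_periodic (Λ := Λ) m hΛ a (y := 0)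
        (fun x _ => ⟨0, by simp⟩) (rep b m q) γ
      have h3 : ((rep b m q + (m : ℤ) • γ : Λ) : EuclideanSpace ℝ (Fin n)) =
        (repEquiv b m (q, γ) : EuclideanSpace ℝ (Fin n)) := rfl
      rw [h3] at h2
      simp only [inner_zero_left, mul_zero, add_zero] at h2
      rw [gauss_add_real, div_mul_eq_mul_div, h2, h1, quadForm_smul, gauss_smul, ← hρ]
      push_cast
      ring
    simp only [hterm]
    rw [tsum_mul_left, h]
    rw [mul_assoc ((m : ℂ) ^ 2), mul_assoc ((m : ℂ) ^ 2), mul_left_comm (eChar _),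
      ← tsum_mul_left (a := eChar _)]
    congr 3
    funext k
    rw [add_div, eChar_add, inner_smul_right]
    rw [show 2 * ((m : ℝ)⁻¹ * inner ℝ (dualLatVec b k) ρ) =
      2 * inner ℝ (dualLatVec b k) ρ / m by ring]
    ring
  simp only [key]
  rw [← Finset.mul_sum, ← Summable.tsum_finsetSum]
  · congr 2
    funext k
    rw [latGauss, repSum, Finset.mul_sum]
  · intro q _
    have h4 := (summable_quadForm_mul_gauss_dual b M (neg_one_div_im_pos hmu)).norm
    refine Summable.of_norm (h4.congr fun k => ?_)
    rw [norm_mul _ (eChar _), norm_eChar, mul_one]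

end ZLattice

end ThetaInversion

/-! ### Gauss sums modulo primes and the transformation of squared theta series -/

section GaussSums

open MeasureTheory Set ComplexConjugate

lemma eChar_neg (x : ℝ) : eChar (-x) = conj (eChar x) := by
  rw [eChar, eChar, ← Complex.exp_conj]
  congr 1
  rw [map_mul, map_mul, map_mul, Complex.conj_I, Complex.conj_ofReal, Complex.conj_ofReal,
    map_ofNat]
  push_cast
  ring

lemma eChar_eq_one_iff {x : ℝ} : eChar x = 1 ↔ ∃ m : ℤ, x = m := by
  constructor
  · intro h
    rw [eChar, Complex.exp_eq_one_iff] at h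
    obtain ⟨m, hm⟩ := h
    refine ⟨m, ?_⟩
    have h2 : (2 * Real.pi * Complex.I : ℂ) ≠ 0 := by simp [Real.pi_ne_zero]
    rw [mul_comm] at hm
    exact_mod_cast mul_right_cancel₀ h2 hm
  · rintro ⟨m, rfl⟩
    exact eChar_int m

section GaussSum

variable {n : ℕ} {Λ : Submodule ℤ (EuclideanSpace ℝ (Fin n))} (b : Module.Basis (Fin n) ℤ Λ)

/-- Completing the square: if `cy ∈ Λ` and `c‖y‖² ∈ ℤ`, translating the summation variable by `cy`
removes the linear term from the Gauss sum. -/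
lemma latGauss_eq_eChar_mul (m : ℕ) [NeZero m] (hΛ : IsIntegral Λ) {α β c : ℤ}
    (hdet : α * m - β * c = 1) {y : EuclideanSpace ℝ (Fin n)} (hy : y ∈ dual Λ) (hcy : c • y ∈ Λ)
    (hc : ∃ t : ℤ, (c : ℝ) * ‖y‖ ^ 2 = t) :
    latGauss b m β y = eChar (c * ‖y‖ ^ 2 / m) * latGauss b m β 0 := by
  rw [latGauss, latGauss,
    ← repSum_add b m (fun x γ => latGauss_term_periodic m hΛ β hy x γ) ⟨c • y, hcy⟩, repSum, repSum,
    Finset.mul_sum]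
  refine Finset.sum_congr rfl fun q _ => ?_
  set ρ : EuclideanSpace ℝ (Fin n) := (rep b m q).1 with hρ
  obtain ⟨t, ht⟩ := hc
  obtain ⟨r, hr⟩ := hy ρ (rep b m q).2
  have hm : (m : ℝ) ≠ 0 := by exact_mod_cast NeZero.ne m
  have h1 : ((rep b m q + ⟨c • y, hcy⟩ : Λ) : EuclideanSpace ℝ (Fin n)) = ρ + (c : ℝ) • y := by
    rw [Submodule.coe_add, Int.cast_smul_eq_zsmul ℝ]
  rw [h1, ← eChar_add]
  refine Eq.trans ?_ (eChar_add_int _ (α * r + α * t))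
  congr 1
  have hdet' : (α : ℝ) * m - β * c = 1 := by exact_mod_cast hdet
  have hα : (α : ℝ) = (1 + β * c) / m := by
    field_simp
    linarith
  rw [norm_add_sq_real, inner_add_right, inner_smul_right, inner_smul_right, norm_smul, mul_pow,
    Real.norm_eq_abs, sq_abs, inner_zero_left, real_inner_self_eq_norm_sq]
  push_cast
  rw [← ht, ← hr, hα, real_inner_comm y ρ]
  field_simp
  ring

lemma latGauss_zero (m : ℕ) [NeZero m] (β : ℤ) :
    latGauss b m β 0 =
      repSum b m fun ρ => eChar (β * ‖(ρ : EuclideanSpace ℝ (Fin n))‖ ^ 2 / m) := by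
  rw [latGauss]
  simp only [inner_zero_left, mul_zero, add_zero]

lemma latGauss_zero_term_periodic (m : ℕ) [NeZero m] (hΛ : IsIntegral Λ) (β : ℤ) (x γ : Λ) :
    eChar (β * ‖((x + (m : ℤ) • γ : Λ) : EuclideanSpace ℝ (Fin n))‖ ^ 2 / m) =
      eChar (β * ‖(x : EuclideanSpace ℝ (Fin n))‖ ^ 2 / m) := by
  have h := latGauss_term_periodic (Λ := Λ) m hΛ β (y := 0) (fun x _ => ⟨0, by simp⟩) x γ
  simpa only [inner_zero_left, mul_zero, add_zero] using h

/-- If `-1` is a square modulo `p`, the Gauss sum is real: substitute `ρ ↦ iρ` with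
`i² ≡ -1`. -/
lemma conj_latGauss_zero (p : ℕ) [Fact p.Prime] (hp : p % 4 = 1) (hΛ : IsIntegral Λ) (β : ℤ) :
    conj (latGauss b p β 0) = latGauss b p β 0 := by
  have hp0 : (p : ℝ) ≠ 0 := by exact_mod_cast (Fact.out : p.Prime).ne_zero
  obtain ⟨i, hi⟩ := ZMod.exists_sq_eq_neg_one_iff.mpr (show p % 4 ≠ 3 by omega)
  have hi' : ((i.val : ℤ) : ZMod p) = i := by simp
  have hi0 : i ≠ 0 := by
    rintro rfl
    simp at hi
  obtain ⟨s, hs⟩ : ∃ s : ℤ, (i.val : ℤ) * i.val + 1 = p * s := by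
    apply (ZMod.intCast_zmod_eq_zero_iff_dvd _ p).mp
    push_cast at hi' ⊢
    rw [hi', ← hi]
    ring
  rw [latGauss_zero, repSum, map_sum]
  have hbij : Function.Bijective fun q : Fin n → ZMod p => i • q :=
    (Finite.injective_iff_bijective).mp (smul_right_injective _ hi0)
  rw [← hbij.sum_comp fun q => eChar (β * ‖((rep b p q : Λ) : EuclideanSpace ℝ (Fin n))‖ ^ 2 / p)]
  refine Finset.sum_congr rfl fun q _ => ?_
  have h1 : red b p ((i.val : ℤ) • rep b p q) = i • q := by
    rw [map_zsmul, red_rep]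
    ext j
    simp only [Pi.smul_apply, smul_eq_mul, zsmul_eq_mul]
    rw [hi']
  have h2 := eq_rep_red b (m := p)
    (Φ := fun ρ => eChar (β * ‖(ρ : EuclideanSpace ℝ (Fin n))‖ ^ 2 / p))
    (latGauss_zero_term_periodic p hΛ β) ((i.val : ℤ) • rep b p q)
  rw [h1] at h2
  rw [h2, ← eChar_neg]
  obtain ⟨t, ht⟩ := hΛ _ (rep b p q).2
  refine Eq.trans (eChar_add_int _ (β * s * t)).symm ?_
  congr 1
  have hs' : (s : ℝ) = ((i.val : ℤ) * (i.val : ℤ) + 1) / p := by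
    field_simp
    have hs2 : ((i.val : ℤ) : ℝ) * ((i.val : ℤ) : ℝ) + 1 = p * s := by exact_mod_cast hs
    linarith
  rw [Submodule.coe_smul, ← Int.cast_smul_eq_zsmul ℝ, norm_smul, mul_pow, Real.norm_eq_abs, sq_abs,
    ht]
  push_cast at hs' ⊢
  rw [hs']
  field_simp
  ring

variable [DiscreteTopology Λ] [IsZLattice ℝ Λ]

/-- The quadratic form is nondegenerate modulo a prime `p ∤ N`: if `x ∈ Λ` pairs trivially with
`Λ` modulo `p`, then `x / p` lies in the dual, `N x / p` in `Λ`, and hence `x / p` in `Λ`. -/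
lemma sum_eChar_inner_eq_zero (p : ℕ) [Fact p.Prime] (hΛ : IsIntegral Λ) {N : ℤ}
    (hN : ∀ y ∈ dual Λ, ∃ m : ℤ, (N : ℝ) * ‖y‖ ^ 2 = m) (hpN : IsCoprime N p) {β : ℤ}
    (hβ : IsCoprime β p) {q : Fin n → ZMod p} (hq : q ≠ 0) :
    repSum b p (fun ρ => eChar (2 * β * inner ℝ ((rep b p q : Λ) : EuclideanSpace ℝ (Fin n))
      (ρ : EuclideanSpace ℝ (Fin n)) / p)) = 0 := by
  have hp0 : (p : ℝ) ≠ 0 := by exact_mod_cast (Fact.out : p.Prime).ne_zero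
  set x : EuclideanSpace ℝ (Fin n) := (rep b p q).1 with hx
  have hxd : x ∈ dual Λ := mem_dual_of_isIntegral hΛ (rep b p q).2
  by_cases hall : ∀ r : Λ, eChar (2 * β * inner ℝ x (r : EuclideanSpace ℝ (Fin n)) / p) = 1
  · exfalso
    apply hq
    have hd : (p : ℝ)⁻¹ • x ∈ dual Λ := by
      intro r hr
      obtain ⟨s, hs⟩ := eChar_eq_one_iff.mp (hall ⟨r, hr⟩)
      obtain ⟨t, ht⟩ := hxd r hr
      obtain ⟨u, v, huv⟩ := hβ
      have huv' : (u : ℝ) * β + v * p = 1 := by exact_mod_cast huv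
      refine ⟨u * s + v * t, ?_⟩
      push_cast
      rw [← hs, ← ht, inner_smul_right, real_inner_comm x r]
      simp only
      field_simp
      linear_combination (-(inner ℝ x r : ℝ)) * huv'
    have hNx := smul_dual_mem hN hd
    obtain ⟨u, v, huv⟩ := hpN
    have huv' : (u : ℝ) * N + v * p = 1 := by exact_mod_cast huv
    have hmem : (p : ℝ)⁻¹ • x ∈ Λ := by
      have h1 : (p : ℝ)⁻¹ • x = u • N • (p : ℝ)⁻¹ • x + v • x := by
        rw [← Int.cast_smul_eq_zsmul ℝ, ← Int.cast_smul_eq_zsmul ℝ, ← Int.cast_smul_eq_zsmul ℝ,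
          smul_smul, smul_smul, ← add_smul]
        congr 1
        field_simp
        linarith
      rw [h1]
      exact Λ.add_mem (Λ.smul_mem _ hNx) (Λ.smul_mem _ (rep b p q).2)
    rw [← red_rep b p q, red_eq_zero_iff]
    refine ⟨⟨_, hmem⟩, Subtype.ext ?_⟩
    rw [Submodule.coe_smul, ← Int.cast_smul_eq_zsmul ℝ, Int.cast_natCast, smul_inv_smul₀ hp0]
  · push Not at hall
    obtain ⟨r, hr⟩ := hall
    have hper : ∀ z γ : Λ, eChar (2 * β * inner ℝ x ((z + (p : ℤ) • γ : Λ) :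
        EuclideanSpace ℝ (Fin n)) / p) =
        eChar (2 * β * inner ℝ x (z : EuclideanSpace ℝ (Fin n)) / p) := by
      intro z γ
      obtain ⟨t, ht⟩ := hxd γ γ.2
      refine Eq.trans ?_ (eChar_add_int _ (β * t))
      congr 1
      rw [Submodule.coe_add, Submodule.coe_smul, ← Int.cast_smul_eq_zsmul ℝ, inner_add_right,
        inner_smul_right]
      push_cast
      rw [← ht, real_inner_comm x (γ : EuclideanSpace ℝ (Fin n))]
      field_simp
    have h := repSum_add b p (Φ := fun ρ : Λ =>
      eChar (2 * β * inner ℝ x (ρ : EuclideanSpace ℝ (Fin n)) / p)) hper r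
    have h2 : repSum b p (fun z : Λ =>
        eChar (2 * β * inner ℝ x ((z + r : Λ) : EuclideanSpace ℝ (Fin n)) / p)) =
        eChar (2 * β * inner ℝ x (r : EuclideanSpace ℝ (Fin n)) / p) *
        repSum b p (fun ρ : Λ => eChar (2 * β * inner ℝ x (ρ : EuclideanSpace ℝ (Fin n)) / p)) := by
      rw [repSum, repSum, Finset.mul_sum]
      refine Finset.sum_congr rfl fun q _ => ?_
      rw [← eChar_add, Submodule.coe_add, inner_add_right]
      congr 1
      ring
    rw [h2] at h
    by_contra hne
    exact hr (mul_right_cancel₀ hne (by rw [h, one_mul]))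

/-- For a prime `p ≡ 1 (mod 4)` not dividing the level, the square of the Gauss sum is `pⁿ`: the
sum is real, and its absolute value squared is `pⁿ` by orthogonality. -/
theorem latGauss_zero_sq (p : ℕ) [Fact p.Prime] (hp : p % 4 = 1) (hΛ : IsIntegral Λ) {N : ℤ}
    (hN : ∀ y ∈ dual Λ, ∃ m : ℤ, (N : ℝ) * ‖y‖ ^ 2 = m) (hpN : IsCoprime N p) {β : ℤ}
    (hβ : IsCoprime β p) : latGauss b p β 0 ^ 2 = (p : ℂ) ^ n := by
  rw [sq]
  nth_rw 2 [← conj_latGauss_zero b p hp hΛ β]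
  have hp0 : (p : ℝ) ≠ 0 := by exact_mod_cast (Fact.out : p.Prime).ne_zero
  set Φ : Λ → ℂ := fun ρ => eChar (β * ‖(ρ : EuclideanSpace ℝ (Fin n))‖ ^ 2 / p) with hΦ
  have h1 : ∀ r : Fin n → ZMod p, latGauss b p β 0 * conj (Φ (rep b p r)) =
      ∑ q, Φ (rep b p q) * eChar (2 * β * inner ℝ ((rep b p q : Λ) : EuclideanSpace ℝ (Fin n))
        ((rep b p r : Λ) : EuclideanSpace ℝ (Fin n)) / p) := by
    intro r
    rw [latGauss_zero, ← repSum_add b p (latGauss_zero_term_periodic p hΛ β) (rep b p r), repSum,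
      Finset.sum_mul]
    refine Finset.sum_congr rfl fun q _ => ?_
    rw [hΦ]
    simp only
    rw [← eChar_neg, ← eChar_add, ← eChar_add, Submodule.coe_add, norm_add_sq_real]
    congr 1
    ring
  have h2 : latGauss b p β 0 * conj (latGauss b p β 0) =
      ∑ r, latGauss b p β 0 * conj (Φ (rep b p r)) := by
    rw [← Finset.mul_sum, ← map_sum, latGauss_zero b p β]
    rfl
  rw [h2, Finset.sum_congr rfl fun r _ => h1 r, Finset.sum_comm]
  simp only [← Finset.mul_sum]
  rw [Finset.sum_eq_single 0]
  · have h3 : rep b p (0 : Fin n → ZMod p) = 0 := by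
      rw [rep]
      have : (fun i => (((0 : Fin n → ZMod p) i).val : ℤ)) = 0 := by
        ext i
        simp
      rw [this, map_zero]
    rw [h3, hΦ]
    simp [eChar_zero, ZMod.card]
  · intro q _ hq
    rw [show ∑ r, eChar (2 * β * inner ℝ ((rep b p q : Λ) : EuclideanSpace ℝ (Fin n))
        ((rep b p r : Λ) : EuclideanSpace ℝ (Fin n)) / p) = 0 from
      sum_eChar_inner_eq_zero b p hΛ hN hpN hβ hq, mul_zero]
  · simp

end GaussSum

section Transformation

variable {n : ℕ} {Λ : Submodule ℤ (EuclideanSpace ℝ (Fin n))}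

/-- The theta series of `Λ` weighted by the quadratic form with coefficient matrix `M`. -/
noncomputable def quadTheta (Λ : Submodule ℤ (EuclideanSpace ℝ (Fin n)))
    (M : Matrix (Fin n) (Fin n) ℝ) (w : ℂ) : ℂ :=
  ∑' γ : Λ, (quadForm M γ : ℂ) * gauss w (γ : EuclideanSpace ℝ (Fin n))

variable [DiscreteTopology Λ] [IsZLattice ℝ Λ]

/-- Transformation of the squared theta series under `(α β; c p)` with `N ∣ c` and `p ≡ 1 (mod 4)`
prime. -/
theorem quadTheta_sq_transform (hΛ : IsIntegral Λ) {N : ℤ}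
    (hN : ∀ y ∈ dual Λ, ∃ m : ℤ, (N : ℝ) * ‖y‖ ^ 2 = m) {p : ℕ} [Fact p.Prime] (hp : p % 4 = 1)
    (hpN : IsCoprime N p) {α β c : ℤ} (hdet : α * p - β * c = 1) (hc : N ∣ c)
    {M : Matrix (Fin n) (Fin n) ℝ} (hM : M.trace = 0) {τ : ℂ} (hτ : 0 < τ.im) :
    quadTheta Λ M ((α * τ + β) / (c * τ + p)) ^ 2 =
      (c * τ + p) ^ (n + 4) * quadTheta Λ M τ ^ 2 := by
  obtain ⟨b⟩ := exists_latticeBasis Λ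
  obtain ⟨C, hinv, hexp⟩ := exists_theta_expansion_at_rational b hΛ
  have hp0 : (p : ℂ) ≠ 0 := by exact_mod_cast (Fact.out : p.Prime).ne_zero
  have hpR : (0 : ℝ) < p := by exact_mod_cast (Fact.out : p.Prime).pos
  have hτ0 : τ ≠ 0 := by rintro rfl; simp at hτ
  have hden : (c : ℂ) * τ + p ≠ 0 := by
    intro h
    have him := congrArg Complex.im h
    have hre := congrArg Complex.re h
    simp at him hre
    rcases him with hc0 | him
    · rw [hc0] at hre
      simp at hre
      exact (Fact.out : p.Prime).ne_zero hre
    · exact hτ.ne' him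
  have hdet' : (α : ℂ) * p - β * c = 1 := by exact_mod_cast hdet
  -- `(ατ + β) / (cτ + p) = β / p + u`, and inverting `p² u` gives back `-1 / τ` up to `c / p`
  set u : ℂ := τ / (p * (c * τ + p)) with hu
  have harg : ((α : ℂ) * τ + β) / (c * τ + p) = ((β / p : ℝ) : ℂ) + u := by
    have h1 : (β : ℂ) / p + u = (β * (c * τ + p) + τ) / (p * (c * τ + p)) := by
      rw [hu, div_add_div _ _ hp0 (mul_ne_zero hp0 hden), div_eq_div_iff
        (mul_ne_zero hp0 (mul_ne_zero hp0 hden)) (mul_ne_zero hp0 hden)]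
      ring
    push_cast
    rw [h1, div_eq_div_iff hden (mul_ne_zero hp0 hden)]
    linear_combination (τ * (c * τ + p)) * hdet'
  have hinvu : -1 / ((p : ℂ) ^ 2 * u) = ((-(c / p) : ℝ) : ℂ) + -1 / τ := by
    rw [hu]
    push_cast
    field_simp
    ring
  have huim : 0 < u.im := by
    have h1 : u = -1 / (((-(c * p) : ℝ) : ℂ) + ((p ^ 2 : ℝ) : ℂ) * (-1 / τ)) := by
      rw [hu]
      have : ((-(c * p) : ℝ) : ℂ) + ((p ^ 2 : ℝ) : ℂ) * (-1 / τ) = -(p * (c * τ + p)) / τ := by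
        push_cast
        field_simp
        ring
      rw [this]
      field_simp
    rw [h1]
    apply neg_one_div_im_pos
    rw [Complex.add_im, Complex.ofReal_im, zero_add, Complex.im_ofReal_mul]
    exact mul_pos (by positivity) (neg_one_div_im_pos hτ)
  set S := ∑' k, (quadForm M (dualLatVec b k) : ℂ) * gauss (-1 / τ) (dualLatVec b k) with hS
  have hβ : IsCoprime β p := ⟨-c, α, by linear_combination hdet⟩
  have h1 : quadTheta Λ M ((α * τ + β) / (c * τ + p)) =
      (p : ℂ) ^ 2 * (C * gaussFactor n ((p : ℂ) ^ 2 * u) * ((p : ℂ) ^ 2 * u)⁻¹ ^ 2) *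
        (latGauss b p β 0 * S) := by
    rw [quadTheta, harg, hexp p β M u hM huim, hS, ← tsum_mul_left (a := latGauss b p β 0)]
    congr 2
    funext k
    have hyd := dualLatVec_mem b k
    obtain ⟨r, hr⟩ := hc
    have hcy : c • dualLatVec b k ∈ Λ := by
      rw [hr, mul_comm, mul_smul]
      exact Λ.smul_mem _ (smul_dual_mem hN hyd)
    obtain ⟨t, ht⟩ := hN _ hyd
    have hct : ∃ t : ℤ, (c : ℝ) * ‖dualLatVec b k‖ ^ 2 = t := by
      refine ⟨r * t, ?_⟩
      rw [hr]
      push_cast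
      rw [← ht]
      ring
    rw [latGauss_eq_eChar_mul b p hΛ hdet hyd hcy hct, hinvu, gauss_add_real]
    have h2 : eChar (-(c / p) * ‖dualLatVec b k‖ ^ 2) * eChar (c * ‖dualLatVec b k‖ ^ 2 / p) =
        1 := by
      rw [← eChar_add, show -((c : ℝ) / p) * ‖dualLatVec b k‖ ^ 2 + c * ‖dualLatVec b k‖ ^ 2 / p = 0
        by ring, eChar_zero]
    linear_combination (quadForm M (dualLatVec b k) * gauss (-1 / τ) (dualLatVec b k) *
      latGauss b p β 0) * h2
  have h3 : quadTheta Λ M τ = C * gaussFactor n τ * τ⁻¹ ^ 2 * S := hinv M τ hM hτ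
  rw [h1, h3]
  simp only [mul_pow]
  rw [gaussFactor_sq, gaussFactor_sq, latGauss_zero_sq b p hp hΛ hN hpN hβ]
  have h4 : (Complex.I / (2 * ((p : ℂ) ^ 2 * u))) ^ n =
      (Complex.I / (2 * τ)) ^ n * (c * τ + p) ^ n / (p : ℂ) ^ n := by
    rw [← mul_pow, ← div_pow]
    congr 1
    rw [hu]
    field_simp
  rw [h4, hu, pow_add]
  field_simp

end Transformation

end GaussSums

/-! ### The action of `Γ₀(N)` on `Θ₁₁` -/

section CongruenceAction

open MeasureTheory Set

section Theta11

variable {n : ℕ} {Λ : Submodule ℤ (EuclideanSpace ℝ (Fin n))}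

/-- Coefficient matrix of `xᵢ xⱼ`. -/
def mixedMatrix (i j : Fin n) : Matrix (Fin n) (Fin n) ℝ := Matrix.single i j 1

/-- Coefficient matrix of `n xᵢ² - ∑ⱼ xⱼ²`. -/
def diagMatrix (i : Fin n) : Matrix (Fin n) (Fin n) ℝ := (n : ℝ) • Matrix.single i i 1 - 1

lemma trace_mixedMatrix {i j : Fin n} (h : i ≠ j) : (mixedMatrix i j).trace = 0 :=
  Matrix.trace_single_eq_of_ne i j 1 h

lemma trace_diagMatrix (i : Fin n) : (diagMatrix i).trace = 0 := by
  simp [diagMatrix, Matrix.trace_sub, Matrix.trace_single_eq_same]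

lemma quadForm_mixedMatrix (i j : Fin n) : quadForm (mixedMatrix i j) = mixed i j := by
  funext x
  simp only [quadForm, mixedMatrix, mixed, Matrix.single_apply]
  rw [Finset.sum_eq_single i, Finset.sum_eq_single j]
  · simp
  · intro k _ hk
    simp [hk.symm]
  · simp
  · intro k _ hk
    simp [hk.symm]
  · simp

lemma quadForm_diagMatrix (i : Fin n) : quadForm (diagMatrix i) = LatticeTheta.diag i := by
  funext x
  have h1 : ∀ k l : Fin n, diagMatrix i k l * (x k * x l) =
      n * (mixedMatrix i i k l * (x k * x l)) -
        (1 : Matrix (Fin n) (Fin n) ℝ) k l * (x k * x l) := by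
    intro k l
    simp only [diagMatrix, mixedMatrix, Matrix.sub_apply, Matrix.smul_apply, smul_eq_mul]
    ring
  have h2 := congrFun (quadForm_mixedMatrix i i) x
  rw [quadForm] at h2
  simp only [quadForm, h1, Finset.sum_sub_distrib, ← Finset.mul_sum, h2, LatticeTheta.diag, mixed]
  simp [Matrix.one_apply, sq]

lemma theta_mixed (i j : Fin n) (τ : UpperHalfPlane) :
    theta (mixed i j) Λ τ = quadTheta Λ (mixedMatrix i j) τ := by
  rw [quadTheta, quadForm_mixedMatrix]
  rfl

lemma theta_diag (i : Fin n) (τ : UpperHalfPlane) :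
    theta (LatticeTheta.diag i) Λ τ = quadTheta Λ (diagMatrix i) τ := by
  rw [quadTheta, quadForm_diagMatrix]
  rfl

/-- `Θ₁₁` is a fixed linear combination of squares of harmonic quadratic theta series, so it
inherits a transformation law that these squares share. -/
lemma theta11_eq_mul {τ τ' : UpperHalfPlane} {a : ℂ}
    (h : ∀ M : Matrix (Fin n) (Fin n) ℝ, M.trace = 0 →
      quadTheta Λ M τ' ^ 2 = a * quadTheta Λ M τ ^ 2) :
    theta11 Λ τ' = a * theta11 Λ τ := by
  rw [theta11, theta11, mul_add, mul_left_comm]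
  congr 1
  · congr 1
    rw [Finset.mul_sum]
    refine Finset.sum_congr rfl fun i _ => ?_
    rw [Finset.mul_sum]
    refine Finset.sum_congr rfl fun j hj => ?_
    rw [theta_mixed, theta_mixed, h _ (trace_mixedMatrix (Finset.mem_Ioi.mp hj).ne)]
  · rw [Finset.mul_sum]
    refine Finset.sum_congr rfl fun i _ => ?_
    rw [theta_diag, theta_diag, h _ (trace_diagMatrix i)]

lemma quadTheta_add_int (hΛ : IsIntegral Λ) (M : Matrix (Fin n) (Fin n) ℝ) (j : ℤ) (w : ℂ) :
    quadTheta Λ M (j + w) = quadTheta Λ M w := by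
  refine tsum_congr fun γ => ?_
  obtain ⟨t, ht⟩ := hΛ γ γ.2
  have h := gauss_add_real (j : ℝ) w (γ : EuclideanSpace ℝ (Fin n))
  rw [ht] at h
  rw [Complex.ofReal_intCast] at h
  rw [h, show (j : ℝ) * t = ((j * t : ℤ) : ℝ) by push_cast; rfl, eChar_int, one_mul]

lemma theta11_slash_T_zpow (hΛ : IsIntegral Λ) (k j : ℤ) :
    theta11 Λ ∣[k] (ModularGroup.T ^ j) = theta11 Λ := by
  funext τ
  rw [ModularForm.SL_slash_apply, ModularGroup.denom_apply, ModularGroup.coe_T_zpow,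
    UpperHalfPlane.modular_T_zpow_smul]
  have h := theta11_eq_mul (Λ := Λ) (τ := τ) (τ' := (j : ℝ) +ᵥ τ) (a := 1) fun M _ => by
    rw [UpperHalfPlane.coe_vadd, one_mul, Complex.ofReal_intCast, quadTheta_add_int hΛ]
  simp [h]

lemma slash_neg_SL2 (F : UpperHalfPlane → ℂ) (k : ℤ) (g : SL(2, ℤ)) :
    F ∣[k] (-g) = (-1 : ℂ) ^ k • (F ∣[k] g) := by
  funext τ
  rw [Pi.smul_apply, ModularForm.SL_slash_apply, ModularForm.SL_slash_apply,
    ModularGroup.SL_neg_smul, ModularGroup.denom_apply, ModularGroup.denom_apply]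
  have : (((-g) 1 0 : ℤ) : ℂ) * τ + ((-g) 1 1 : ℤ) = (-1) * ((g 1 0 : ℂ) * τ + (g 1 1 : ℂ)) := by
    simp
    ring
  rw [this, mul_zpow, smul_eq_mul]
  have h2 : (-1 : ℂ) ^ (-k) = (-1 : ℂ) ^ k := by
    rw [zpow_neg, ← inv_zpow]
    norm_num
  rw [h2]
  ring

lemma neg_one_zpow_add_four (n : ℕ) : (-1 : ℂ) ^ ((n : ℤ) + 4) = (-1) ^ n := by
  rw [zpow_add₀ (by norm_num), zpow_natCast]
  norm_num

/-- Dirichlet's theorem provides a prime `≡ 1 (mod 4)` in the progression `d + cℤ`, unless `4 ∣ c`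
and `d ≢ 1 (mod 4)`. -/
lemma exists_prime_in_progression {c d : ℤ} (hc : c ≠ 0) (hcd : IsCoprime d c)
    (h : ¬ 4 ∣ c ∨ d % 4 = 1) :
    ∃ (j : ℤ) (p : ℕ), p.Prime ∧ p % 4 = 1 ∧ d + j * c = p := by
  obtain ⟨j₀, hj₀⟩ : ∃ j₀ : ℤ, (d + j₀ * c) % 4 = 1 := by
    by_cases h4 : d % 4 = 1
    · exact ⟨0, by simpa using h4⟩
    have h4c : ¬ 4 ∣ c := h.resolve_right h4
    have hpar : ¬ (2 ∣ c ∧ 2 ∣ d) := by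
      rintro ⟨h1, h2⟩
      have := hcd.isUnit_of_dvd' h2 h1
      rw [Int.isUnit_iff] at this
      omega
    have hcases : c % 4 = 1 ∨ c % 4 = 3 ∨ (c % 4 = 2 ∧ d % 4 = 3) := by omega
    rcases hcases with h1 | h1 | ⟨h1, h2⟩
    · refine ⟨1 - d, ?_⟩
      obtain ⟨t, ht⟩ : ∃ t, c = 4 * t + 1 := ⟨c / 4, by omega⟩
      rw [ht, show d + (1 - d) * (4 * t + 1) = 4 * ((1 - d) * t) + 1 by ring]
      omega
    · refine ⟨d - 1, ?_⟩
      obtain ⟨t, ht⟩ : ∃ t, c = 4 * t + 3 := ⟨c / 4, by omega⟩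
      rw [ht, show d + (d - 1) * (4 * t + 3) = 4 * ((d - 1) * t + d - 1) + 1 by ring]
      omega
    · exact ⟨1, by omega⟩
  set a := d + j₀ * c with ha
  have hac : IsCoprime a c := by
    rw [ha]
    exact IsCoprime.add_mul_right_left hcd j₀
  have ha4 : IsCoprime a 4 := ⟨1, -(a / 4), by omega⟩
  have hq : ((4 * c.natAbs : ℕ) : ℤ) = 4 * |c| := by push_cast; rfl
  have hcop : IsCoprime a ((4 * c.natAbs : ℕ) : ℤ) := by
    rw [hq]
    exact ha4.mul_right (hac.abs_right)
  obtain ⟨p, -, hp, hmod⟩ := Nat.forall_exists_prime_gt_and_zmodEq 0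
    (q := 4 * c.natAbs) (by simpa using hc) hcop
  rw [hq] at hmod
  have hdvd := hmod.symm.dvd
  obtain ⟨t, ht⟩ := hdvd
  have hp4 : (p : ℤ) % 4 = 1 := by
    rw [show (p : ℤ) = a + 4 * (|c| * t) by linear_combination ht]
    omega
  rcases abs_choice c with h1 | h1
  · refine ⟨j₀ + 4 * t, p, hp, by omega, ?_⟩
    rw [h1] at ht
    linear_combination -ht
  · refine ⟨j₀ - 4 * t, p, hp, by omega, ?_⟩
    rw [h1] at ht
    linear_combination -ht

variable [DiscreteTopology Λ] [IsZLattice ℝ Λ]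

lemma SL2_det_eq (g : SL(2, ℤ)) : g 0 0 * g 1 1 - g 0 1 * g 1 0 = 1 := by
  have := g.det_coe
  rwa [Matrix.det_fin_two] at this

lemma theta11_slash_of_prime (hΛ : IsIntegral Λ) {N : ℤ}
    (hN : ∀ y ∈ dual Λ, ∃ m : ℤ, (N : ℝ) * ‖y‖ ^ 2 = m) {g : SL(2, ℤ)} (hg : N ∣ g 1 0)
    {p : ℕ} (hpp : p.Prime) (hp : p % 4 = 1) (hgp : g 1 1 = p) :
    theta11 Λ ∣[(n : ℤ) + 4] g = theta11 Λ := by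
  have : Fact p.Prime := ⟨hpp⟩
  funext τ
  have hdet := SL2_det_eq g
  rw [hgp] at hdet
  have hpN : IsCoprime N p := by
    obtain ⟨r, hr⟩ := hg
    exact ⟨-(g 0 1 * r), g 0 0, by rw [hr] at hdet; linear_combination hdet⟩
  have hden := UpperHalfPlane.denom_ne_zero
    (Matrix.SpecialLinearGroup.toGL ((Matrix.SpecialLinearGroup.map (Int.castRingHom ℝ)) g)) τ
  rw [ModularForm.SL_slash_apply]
  rw [ModularGroup.denom_apply] at hden ⊢
  rw [hgp, Int.cast_natCast] at hden ⊢
  have h := theta11_eq_mul (Λ := Λ) (τ := τ) (τ' := g • τ)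
    (a := ((g 1 0 : ℂ) * τ + p) ^ (n + 4)) fun M hM => by
      have := quadTheta_sq_transform hΛ hN hp hpN hdet hg hM τ.coe_im_pos
      rw [← this, UpperHalfPlane.coe_specialLinearGroup_apply, hgp]
      simp
  rw [h, zpow_neg]
  have h2 : ((g 1 0 : ℂ) * τ + p) ^ ((n : ℤ) + 4) = ((g 1 0 : ℂ) * τ + p) ^ (n + 4) := by
    exact_mod_cast zpow_natCast ((g 1 0 : ℂ) * τ + p) (n + 4)
  rw [h2]
  field_simp

/-- `Θ₁₁` is invariant under the matrices in `Γ₀(N)` with lower row `(c, d)` such that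
`d ≡ 1 (mod 4)` or `4 ∤ c`. -/
lemma theta11_slash_eq_self (hΛ : IsIntegral Λ) {N : ℤ}
    (hN : ∀ y ∈ dual Λ, ∃ m : ℤ, (N : ℝ) * ‖y‖ ^ 2 = m) {g : SL(2, ℤ)} (hg : N ∣ g 1 0)
    (h : ¬ 4 ∣ g 1 0 ∨ g 1 1 % 4 = 1) :
    theta11 Λ ∣[(n : ℤ) + 4] g = theta11 Λ := by
  have hdet := SL2_det_eq g
  by_cases hc : g 1 0 = 0
  · rw [hc, mul_zero, sub_zero] at hdet
    have hd : g 1 1 = 1 := by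
      rcases Int.isUnit_iff.mp (IsUnit.of_mul_eq_one_right _ hdet) with h1 | h1
      · exact h1
      · rw [hc, h1] at h
        simp at h
    rw [hd, mul_one] at hdet
    have : g = ModularGroup.T ^ (g 0 1) := by
      ext i j
      rw [ModularGroup.coe_T_zpow]
      fin_cases i <;> fin_cases j <;> simp [hc, hd, hdet]
    rw [this, theta11_slash_T_zpow hΛ]
  · -- multiplication by `T ^ j` replaces `d` by `d + j c`, which can be made a prime
    obtain ⟨j, p, hpp, hp, hj⟩ := exists_prime_in_progression hc
      (d := g 1 1) ⟨g 0 0, -g 0 1, by linear_combination hdet⟩ h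
    have h10 : (g * ModularGroup.T ^ j) 1 0 = g 1 0 := by
      rw [Matrix.SpecialLinearGroup.coe_mul, ModularGroup.coe_T_zpow]
      simp [Matrix.mul_apply, Fin.sum_univ_two]
    have h11 : (g * ModularGroup.T ^ j) 1 1 = p := by
      rw [Matrix.SpecialLinearGroup.coe_mul, ModularGroup.coe_T_zpow, ← hj]
      simp [Matrix.mul_apply, Fin.sum_univ_two]
      ring
    have h1 := theta11_slash_of_prime hΛ hN (g := g * ModularGroup.T ^ j) (by rwa [h10]) hpp hp h11
    have h2 : g = (g * ModularGroup.T ^ j) * ModularGroup.T ^ (-j) := by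
      rw [mul_assoc, ← zpow_add, add_neg_cancel, zpow_zero, mul_one]
    rw [h2, SlashAction.slash_mul, h1, theta11_slash_T_zpow hΛ]

lemma theta11_slash_eq_neg_one_pow (hΛ : IsIntegral Λ) {N : ℤ}
    (hN : ∀ y ∈ dual Λ, ∃ m : ℤ, (N : ℝ) * ‖y‖ ^ 2 = m) {g : SL(2, ℤ)} (hg : N ∣ g 1 0)
    (h : ¬ 4 ∣ g 1 0 ∨ g 1 1 % 4 = 3) :
    theta11 Λ ∣[(n : ℤ) + 4] g = (-1 : ℂ) ^ n • theta11 Λ := by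
  have h10 : (-g) 1 0 = -g 1 0 := by simp
  have h11 : (-g) 1 1 = -g 1 1 := by simp
  have h1 := theta11_slash_eq_self hΛ hN (g := -g) (by rw [h10]; exact hg.neg_right) (by
    rw [h10, h11, Int.dvd_neg]
    rcases h with h | h
    · exact Or.inl h
    · right
      omega)
  rw [← neg_neg g, slash_neg_SL2, h1, neg_one_zpow_add_four]

lemma odd_of_four_dvd {g : SL(2, ℤ)} (h : 4 ∣ g 1 0) : g 1 1 % 4 = 1 ∨ g 1 1 % 4 = 3 := by
  have hdet := SL2_det_eq g
  obtain ⟨t, ht⟩ := h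
  by_contra hcon
  have h2 : g 1 1 % 2 = 0 := by omega
  obtain ⟨s, hs⟩ : ∃ s, g 1 1 = 2 * s := ⟨g 1 1 / 2, by omega⟩
  rw [ht, hs] at hdet
  have h3 : 2 * (g 0 0 * s - g 0 1 * 2 * t) = 1 := by linear_combination hdet
  omega

/-- In odd dimension `Θ₁₁` vanishes if `Γ₀(N)` contains a matrix with `4 ∤ c`, since then
`Θ₁₁ ∣ g` is both `Θ₁₁` and `-Θ₁₁`. -/
lemma theta11_eq_zero (hn : Odd n) (hΛ : IsIntegral Λ) {N : ℤ}
    (hN : ∀ y ∈ dual Λ, ∃ m : ℤ, (N : ℝ) * ‖y‖ ^ 2 = m) {g : SL(2, ℤ)} (hg : N ∣ g 1 0)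
    (h : ¬ 4 ∣ g 1 0) : theta11 Λ = 0 := by
  have h1 := theta11_slash_eq_self hΛ hN hg (Or.inl h)
  have h2 := theta11_slash_eq_neg_one_pow hΛ hN hg (Or.inl h)
  rw [h1, hn.neg_one_pow, neg_one_smul] at h2
  exact self_eq_neg.mp h2

/-- The sign `(-1)ⁿ` by which `-1 ∈ Γ₀(N)` acts is trivial in even dimension. -/
lemma theta11_slash_of_even (hn : Even n) (hΛ : IsIntegral Λ) {N : ℤ}
    (hN : ∀ y ∈ dual Λ, ∃ m : ℤ, (N : ℝ) * ‖y‖ ^ 2 = m) {g : SL(2, ℤ)} (hg : N ∣ g 1 0) :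
    theta11 Λ ∣[(n : ℤ) + 4] g = theta11 Λ := by
  by_cases h4 : 4 ∣ g 1 0
  · rcases odd_of_four_dvd h4 with h | h
    · exact theta11_slash_eq_self hΛ hN hg (Or.inr h)
    · rw [theta11_slash_eq_neg_one_pow hΛ hN hg (Or.inr h), hn.neg_one_pow, one_smul]
  · exact theta11_slash_eq_self hΛ hN hg (Or.inl h4)

lemma theta11_slash_of_odd (hn : Odd n) (hΛ : IsIntegral Λ) {N : ℤ}
    (hN : ∀ y ∈ dual Λ, ∃ m : ℤ, (N : ℝ) * ‖y‖ ^ 2 = m) {g : SL(2, ℤ)} (hg : N ∣ g 1 0) :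
    theta11 Λ ∣[(n : ℤ) + 4] g =
      (((ZMod.χ₄ ((g 1 1 : ℤ) : ZMod 4) : ℤ) : ℂ)) • theta11 Λ := by
  by_cases h4 : 4 ∣ g 1 0
  · rcases odd_of_four_dvd h4 with h | h
    · rw [theta11_slash_eq_self hΛ hN hg (Or.inr h), ZMod.χ₄_int_one_mod_four h, Int.cast_one,
        one_smul]
    · rw [theta11_slash_eq_neg_one_pow hΛ hN hg (Or.inr h), ZMod.χ₄_int_three_mod_four h,
        hn.neg_one_pow, Int.cast_neg, Int.cast_one]
  · rw [theta11_eq_zero hn hΛ hN hg h4, SlashAction.zero_slash, smul_zero]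

/-- If `4 ∣ N`, then `d ≡ 1 (mod 4)` on `Γ₁(N)`. Otherwise the matrix with rows `(1, 0)` and
`(N, 1)` shows that `Θ₁₁` vanishes. -/
lemma theta11_slash_Gamma1_of_odd (hn : Odd n) (hΛ : IsIntegral Λ) {N : ℤ}
    (hN : ∀ y ∈ dual Λ, ∃ m : ℤ, (N : ℝ) * ‖y‖ ^ 2 = m) {g : SL(2, ℤ)} (hg : N ∣ g 1 0)
    (hg1 : N ∣ g 1 1 - 1) : theta11 Λ ∣[(n : ℤ) + 4] g = theta11 Λ := by
  by_cases h4 : 4 ∣ N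
  · refine theta11_slash_eq_self hΛ hN hg (Or.inr ?_)
    have := h4.trans hg1
    omega
  · have hdet : (!![1, 0; N, 1] : Matrix (Fin 2) (Fin 2) ℤ).det = 1 := by
      simp [Matrix.det_fin_two]
    rw [theta11_eq_zero hn hΛ hN (g := ⟨!![1, 0; N, 1], hdet⟩) (by simp) (by simpa using h4),
      SlashAction.zero_slash]

end Theta11

end CongruenceAction

/-! ### Holomorphy and behaviour at the cusps -/

section Cusps

open MeasureTheory Set Filter Topology Manifold

section Analytic

variable {n : ℕ} {Λ : Submodule ℤ (EuclideanSpace ℝ (Fin n))}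

/-- Vanishing of `Θ₁₁` under a transformation `g` follows from that of the squared theta series. -/
lemma isZeroAtImInfty_theta11_slash {k : ℤ} {g : SL(2, ℤ)}
    (h : ∀ M : Matrix (Fin n) (Fin n) ℝ, M.trace = 0 → Tendsto (fun τ : UpperHalfPlane =>
      quadTheta Λ M (g • τ : UpperHalfPlane) ^ 2 * ((g 1 0 : ℂ) * τ + (g 1 1 : ℂ)) ^ (-k))
      UpperHalfPlane.atImInfty (𝓝 0)) :
    UpperHalfPlane.IsZeroAtImInfty (theta11 Λ ∣[k] g) := by
  have heq : theta11 Λ ∣[k] g = fun τ : UpperHalfPlane =>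
      2 * (n : ℂ) ^ 2 * (∑ i : Fin n, ∑ j ∈ Finset.Ioi i,
        quadTheta Λ (mixedMatrix i j) (g • τ : UpperHalfPlane) ^ 2 *
          ((g 1 0 : ℂ) * τ + (g 1 1 : ℂ)) ^ (-k)) +
        ∑ i : Fin n, quadTheta Λ (diagMatrix i) (g • τ : UpperHalfPlane) ^ 2 *
          ((g 1 0 : ℂ) * τ + (g 1 1 : ℂ)) ^ (-k) := by
    funext τ
    rw [ModularForm.SL_slash_apply, ModularGroup.denom_apply, theta11]
    simp only [theta_mixed, theta_diag, add_mul, ← Finset.sum_mul, mul_assoc]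
  rw [UpperHalfPlane.IsZeroAtImInfty, ZeroAtFilter, heq]
  have h1 : Tendsto (fun τ : UpperHalfPlane => ∑ i : Fin n, ∑ j ∈ Finset.Ioi i,
        quadTheta Λ (mixedMatrix i j) (g • τ : UpperHalfPlane) ^ 2 *
          ((g 1 0 : ℂ) * τ + (g 1 1 : ℂ)) ^ (-k)) UpperHalfPlane.atImInfty
      (𝓝 (∑ i : Fin n, ∑ j ∈ Finset.Ioi i, 0)) :=
    tendsto_finsetSum _ fun i _ => tendsto_finsetSum _ fun j hj =>
      h _ (trace_mixedMatrix (Finset.mem_Ioi.mp hj).ne)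
  have h2 : Tendsto (fun τ : UpperHalfPlane => ∑ i : Fin n,
        quadTheta Λ (diagMatrix i) (g • τ : UpperHalfPlane) ^ 2 *
          ((g 1 0 : ℂ) * τ + (g 1 1 : ℂ)) ^ (-k)) UpperHalfPlane.atImInfty
      (𝓝 (∑ i : Fin n, 0)) :=
    tendsto_finsetSum _ fun i _ => h _ (trace_diagMatrix i)
  simpa using (h1.const_mul (2 * (n : ℂ) ^ 2)).add h2

variable [DiscreteTopology Λ] [IsZLattice ℝ Λ]

lemma differentiableOn_quadTheta (M : Matrix (Fin n) (Fin n) ℝ) :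
    DifferentiableOn ℂ (quadTheta Λ M) {z | 0 < z.im} := by
  intro z hz
  have hz : 0 < z.im := hz
  obtain ⟨C, hC⟩ := norm_quadForm_mul_gauss_le M (n + 1) (half_pos hz)
  have hU : IsOpen {w : ℂ | z.im / 2 < w.im} := isOpen_lt continuous_const Complex.continuous_im
  have h : DifferentiableOn ℂ (quadTheta Λ M) {w : ℂ | z.im / 2 < w.im} := by
    refine Complex.differentiableOn_tsum_of_summable_norm
      ((summable_one_add_norm_lattice (Λ := Λ)).mul_left C) (fun γ => ?_) hU
      (fun γ w hw => hC w γ (le_of_lt hw))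
    unfold gauss
    fun_prop
  exact (h.differentiableAt (hU.mem_nhds (half_lt_self hz))).differentiableWithinAt

lemma mdifferentiable_quadTheta (M : Matrix (Fin n) (Fin n) ℝ) :
    MDiff fun τ : UpperHalfPlane => quadTheta Λ M τ := by
  rw [UpperHalfPlane.mdifferentiable_iff]
  refine (differentiableOn_quadTheta (Λ := Λ) M).congr fun z hz => ?_
  rw [Function.comp_apply, UpperHalfPlane.ofComplex_apply_of_im_pos hz]

lemma mdifferentiable_theta11 : MDiff (theta11 Λ) := by
  have h : theta11 Λ = fun τ : UpperHalfPlane =>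
      2 * (n : ℂ) ^ 2 * (∑ i : Fin n, ∑ j ∈ Finset.Ioi i,
        quadTheta Λ (mixedMatrix i j) τ * quadTheta Λ (mixedMatrix i j) τ) +
        ∑ i : Fin n, quadTheta Λ (diagMatrix i) τ * quadTheta Λ (diagMatrix i) τ := by
    funext τ
    simp only [theta11, theta_mixed, theta_diag, sq]
  rw [h, UpperHalfPlane.mdifferentiable_iff]
  have hd : ∀ M : Matrix (Fin n) (Fin n) ℝ, DifferentiableOn ℂ
      (fun z => quadTheta Λ M (UpperHalfPlane.ofComplex z)) {z | 0 < z.im} := fun M =>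
    UpperHalfPlane.mdifferentiable_iff.mp (mdifferentiable_quadTheta M)
  simp only [Function.comp_def]
  refine DifferentiableOn.add (DifferentiableOn.const_mul ?_ _) ?_
  · exact DifferentiableOn.fun_sum fun i _ => DifferentiableOn.fun_sum fun j _ =>
      (hd _).mul (hd _)
  · exact DifferentiableOn.fun_sum fun i _ => (hd _).mul (hd _)

/-- A Gaussian sum with a quadratic weight, twisted by bounded coefficients, tends to zero at
`i∞`, the weight being zero at the origin. -/
lemma tendsto_tsum_quadForm_mul_gauss {ι : Type*} {v : ι → EuclideanSpace ℝ (Fin n)}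
    (hv : Summable fun i => (1 + ‖v i‖) ^ (-((n + 1 : ℕ) : ℝ))) (M : Matrix (Fin n) (Fin n) ℝ)
    {G : ι → ℂ} {K : ℝ} (hG : ∀ i, ‖G i‖ ≤ K) (t : ℝ) :
    Tendsto (fun τ : UpperHalfPlane => ∑' i, (quadForm M (v i) * gauss (t + τ) (v i)) * G i)
      UpperHalfPlane.atImInfty (𝓝 0) := by
  obtain ⟨C, hC⟩ := norm_quadForm_mul_gauss_le M (n + 1) one_pos
  have him : ∀ τ : UpperHalfPlane, ((t : ℂ) + τ).im = τ.im := fun τ => by simp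
  have h1 : ∀ᶠ τ : UpperHalfPlane in UpperHalfPlane.atImInfty, 1 ≤ τ.im :=
    (UpperHalfPlane.atImInfty_mem _).mpr ⟨1, fun z hz => hz⟩
  rw [← tsum_zero (α := ℂ) (β := ι)]
  refine tendsto_tsum_of_dominated_convergence ((hv.mul_left C).mul_right K) (fun i => ?_) ?_
  · by_cases h0 : v i = 0
    · simp [h0, quadForm_zero]
    · have hpos : 0 < 2 * Real.pi * ‖v i‖ ^ 2 := by
        have := norm_pos_iff.mpr h0
        positivity
      have h2 : Tendsto (fun τ : UpperHalfPlane => gauss (t + τ) (v i))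
          UpperHalfPlane.atImInfty (𝓝 0) := by
        rw [tendsto_zero_iff_norm_tendsto_zero]
        simp only [norm_gauss, him]
        refine Real.tendsto_exp_atBot.comp ?_
        have h3 : Tendsto (fun τ : UpperHalfPlane => τ.im) UpperHalfPlane.atImInfty atTop :=
          tendsto_comap
        have h4 := (h3.const_mul_atTop hpos)
        refine (tendsto_neg_atTop_atBot.comp h4).congr fun τ => ?_
        simp only [Function.comp_apply]
        ring
      simpa using (h2.const_mul (quadForm M (v i) : ℂ)).mul_const (G i)
  · filter_upwards [h1] with τ hτ i
    rw [norm_mul]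
    have h5 := hC (t + τ) (v i) (by rw [him]; exact hτ)
    exact mul_le_mul h5 (hG i) (norm_nonneg _) ((norm_nonneg _).trans h5)

lemma isZeroAtImInfty_theta11 : UpperHalfPlane.IsZeroAtImInfty (theta11 Λ) := by
  have h := isZeroAtImInfty_theta11_slash (Λ := Λ) (k := 0) (g := 1) fun M _ => by
    have h1 := tendsto_tsum_quadForm_mul_gauss (summable_one_add_norm_lattice (Λ := Λ)) M
      (G := fun _ => 1) (K := 1) (by simp) 0
    have h2 : Tendsto (fun τ : UpperHalfPlane => quadTheta Λ M τ) UpperHalfPlane.atImInfty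
        (𝓝 0) := by
      refine h1.congr fun τ => ?_
      simp [quadTheta]
    simpa using h2.pow 2
  simpa using h

/-- Behaviour at the cusp `a/c`: expanding around `a/c` writes `Θ² ∣ g` as a constant times the
square of a twisted theta series of the dual lattice. -/
lemma isZeroAtImInfty_theta11_slash_of_pos (hΛ : IsIntegral Λ) {g : SL(2, ℤ)} (hg : 0 < g 1 0) :
    UpperHalfPlane.IsZeroAtImInfty (theta11 Λ ∣[(n : ℤ) + 4] g) := by
  refine isZeroAtImInfty_theta11_slash fun M hM => ?_
  obtain ⟨b⟩ := exists_latticeBasis Λ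
  obtain ⟨C, -, hexp⟩ := exists_theta_expansion_at_rational b hΛ
  obtain ⟨c, hc⟩ := Int.eq_ofNat_of_zero_le hg.le
  have hcpos : 0 < c := by omega
  have : NeZero c := ⟨hcpos.ne'⟩
  have hc0 : (c : ℂ) ≠ 0 := by exact_mod_cast hcpos.ne'
  have hcR : (0 : ℝ) < c := by exact_mod_cast hcpos
  have hdet := SL2_det_eq g
  have hdet' : (g 0 0 : ℂ) * g 1 1 - g 0 1 * g 1 0 = 1 := by exact_mod_cast hdet
  rw [hc, Int.cast_natCast] at hdet'
  set S : UpperHalfPlane → ℂ := fun τ => ∑' k, (quadForm M (dualLatVec b k) *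
    gauss (((g 1 1 / c : ℝ) : ℂ) + τ) (dualLatVec b k)) *
      latGauss b c (g 0 0) (dualLatVec b k) with hS
  have hSlim : Tendsto S UpperHalfPlane.atImInfty (𝓝 0) :=
    tendsto_tsum_quadForm_mul_gauss (summable_one_add_norm_dualLatVec b) M
      (fun k => norm_latGauss_le b c (g 0 0) _) _
  have key : ∀ τ : UpperHalfPlane,
      quadTheta Λ M (g • τ : UpperHalfPlane) ^ 2 *
        ((g 1 0 : ℂ) * τ + (g 1 1 : ℂ)) ^ (-((n : ℤ) + 4)) =
      (C ^ 2 * (-Complex.I / (2 * c)) ^ n) * S τ ^ 2 := by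
    intro τ
    have hden := UpperHalfPlane.denom_ne_zero
      (Matrix.SpecialLinearGroup.toGL ((Matrix.SpecialLinearGroup.map (Int.castRingHom ℝ)) g)) τ
    rw [ModularGroup.denom_apply, hc, Int.cast_natCast] at hden
    rw [hc, Int.cast_natCast]
    set z : ℂ := c * τ + (g 1 1 : ℂ) with hz
    -- `g τ = a / c + u`, and inverting `c² u` gives `τ + d / c`
    set u : ℂ := -1 / (c * z) with hu
    have hzim : 0 < (c * z).im := by
      rw [show (c : ℂ) = ((c : ℝ) : ℂ) by simp, Complex.im_ofReal_mul]
      refine mul_pos hcR ?_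
      rw [hz, Complex.add_im, Complex.intCast_im, add_zero,
        show (c : ℂ) = ((c : ℝ) : ℂ) by simp, Complex.im_ofReal_mul]
      exact mul_pos hcR τ.coe_im_pos
    have harg : ((g • τ : UpperHalfPlane) : ℂ) = ((g 0 0 / c : ℝ) : ℂ) + u := by
      rw [UpperHalfPlane.coe_specialLinearGroup_apply, hc]
      simp only [algebraMap_int_eq, eq_intCast, Int.cast_natCast, Complex.ofReal_natCast,
        Complex.ofReal_intCast]
      rw [← hz, hu]
      push_cast
      rw [div_add_div _ _ hc0 (mul_ne_zero hc0 hden), div_eq_div_iff hden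
        (mul_ne_zero hc0 (mul_ne_zero hc0 hden)), hz]
      linear_combination (-(c : ℂ) * (c * τ + g 1 1)) * hdet'
    have hinv : -1 / ((c : ℂ) ^ 2 * u) = ((g 1 1 / c : ℝ) : ℂ) + τ := by
      rw [hu]
      push_cast
      field_simp
      rw [hz]
      ring
    rw [quadTheta, harg, hexp c (g 0 0) M u hM (neg_one_div_im_pos hzim), hinv]
    change ((c : ℂ) ^ 2 * (C * gaussFactor n ((c : ℂ) ^ 2 * u) * ((c : ℂ) ^ 2 * u)⁻¹ ^ 2) *
      S τ) ^ 2 * _ = _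
    simp only [mul_pow]
    rw [gaussFactor_sq]
    have h4 : (Complex.I / (2 * ((c : ℂ) ^ 2 * u))) ^ n = (-Complex.I / (2 * c)) ^ n * z ^ n := by
      rw [← mul_pow]
      congr 1
      rw [hu]
      field_simp
    have h5 : z ^ (-((n : ℤ) + 4)) = (z ^ (n + 4))⁻¹ := by
      rw [zpow_neg]
      congr 1
    rw [h4, h5, hu, pow_add]
    field_simp
  simp only [key]
  simpa using (hSlim.pow 2).const_mul (C ^ 2 * (-Complex.I / (2 * c)) ^ n)

lemma isZeroAtImInfty_theta11_slash_SL2 (hΛ : IsIntegral Λ) {N : ℤ}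
    (hN : ∀ y ∈ dual Λ, ∃ m : ℤ, (N : ℝ) * ‖y‖ ^ 2 = m) (g : SL(2, ℤ)) :
    UpperHalfPlane.IsZeroAtImInfty (theta11 Λ ∣[(n : ℤ) + 4] g) := by
  have hsmul : ∀ (F : UpperHalfPlane → ℂ) (a : ℂ), UpperHalfPlane.IsZeroAtImInfty F →
      UpperHalfPlane.IsZeroAtImInfty (a • F) := by
    intro F a hF
    have := Tendsto.const_mul a hF
    rw [mul_zero] at this
    exact this
  rcases lt_trichotomy 0 (g 1 0) with h | h | h
  · exact isZeroAtImInfty_theta11_slash_of_pos hΛ h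
  · have hd : N ∣ g 1 0 := by rw [← h]; exact dvd_zero N
    rcases odd_of_four_dvd (g := g) (by rw [← h]; exact dvd_zero 4) with h1 | h1
    · rw [theta11_slash_eq_self hΛ hN hd (Or.inr h1)]
      exact isZeroAtImInfty_theta11
    · rw [theta11_slash_eq_neg_one_pow hΛ hN hd (Or.inr h1)]
      exact hsmul _ _ isZeroAtImInfty_theta11
  · rw [← neg_neg g, slash_neg_SL2]
    exact hsmul _ _ (isZeroAtImInfty_theta11_slash_of_pos hΛ (g := -g) (by simpa using h))

/-- `Θ₁₁` is a cusp form for every finite index subgroup of `SL₂(ℤ)` under which it is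
invariant. -/
lemma exists_cuspForm_theta11 (hΛ : IsIntegral Λ) {N : ℤ}
    (hN : ∀ y ∈ dual Λ, ∃ m : ℤ, (N : ℝ) * ‖y‖ ^ 2 = m) (Γ : Subgroup SL(2, ℤ)) [Γ.FiniteIndex]
    (hΓ : ∀ g ∈ Γ, theta11 Λ ∣[(n : ℤ) + 4] g = theta11 Λ) :
    ∃ F : CuspForm (Γ.map (Matrix.SpecialLinearGroup.mapGL ℝ)) ((n : ℤ) + 4),
      ⇑F = theta11 Λ := by
  refine ⟨{ toFun := theta11 Λ, slash_action_eq' := ?_, holo' := mdifferentiable_theta11,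
            zero_at_cusps' := ?_ }, rfl⟩
  · rintro _ ⟨g, hg, rfl⟩
    exact hΓ g hg
  · intro c hc
    rw [Subgroup.IsArithmetic.isCusp_iff_isCusp_SL2Z] at hc
    rw [OnePoint.isZeroAt_iff_forall_SL2Z hc]
    exact fun g _ => isZeroAtImInfty_theta11_slash_SL2 hΛ hN g

end Analytic

end Cusps

/-! ### The `q`-expansion and the divisibility of its coefficients -/

section QExpansion

open MeasureTheory Set Filter Topology

/-- The zonal polynomial `n²⟨x, y⟩² - n‖x‖²‖y‖²` attached to the harmonic quadratic forms. -/
noncomputable def zonal {n : ℕ} (x y : EuclideanSpace ℝ (Fin n)) : ℝ :=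
  (n : ℝ) ^ 2 * inner ℝ x y ^ 2 - n * (‖x‖ ^ 2 * ‖y‖ ^ 2)

lemma sum_sq_eq_sum_sq_add {n : ℕ} (a : Fin n → ℝ) :
    (∑ i, a i) ^ 2 = ∑ i, a i ^ 2 + 2 * ∑ i, ∑ j ∈ Finset.Ioi i, a i * a j := by
  have h1 : ∀ i j : Fin n, a i * a j = (if i = j then a i * a j else 0) +
      ((if i < j then a i * a j else 0) + if j < i then a i * a j else 0) := by
    intro i j
    rcases lt_trichotomy i j with h | h | h
    · simp [h, h.ne, h.not_gt]
    · simp [h]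
    · simp [h, h.ne', h.not_gt]
  have h2 : ∑ i, ∑ j, (if j < i then a i * a j else 0) =
      ∑ i, ∑ j, if i < j then a i * a j else 0 := by
    rw [Finset.sum_comm]
    refine Finset.sum_congr rfl fun i _ => Finset.sum_congr rfl fun j _ => ?_
    rw [mul_comm]
  have h3 : ∑ i, ∑ j ∈ Finset.Ioi i, a i * a j = ∑ i, ∑ j, if i < j then a i * a j else 0 := by
    refine Finset.sum_congr rfl fun i _ => ?_
    rw [← Finset.sum_filter]
    refine Finset.sum_congr ?_ fun _ _ => rfl
    ext j
    simp
  rw [sq, Finset.sum_mul_sum]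
  simp_rw [fun i => Finset.sum_congr rfl fun j (_ : j ∈ (Finset.univ : Finset (Fin n))) => h1 i j,
    Finset.sum_add_distrib]
  rw [h2, h3, two_mul]
  congr 1
  refine Finset.sum_congr rfl fun i _ => ?_
  simp [sq]

/-- The addition theorem behind the `q`-expansion of `Θ₁₁`. -/
lemma zonal_eq_sum {n : ℕ} (x y : EuclideanSpace ℝ (Fin n)) :
    2 * (n : ℝ) ^ 2 * (∑ i : Fin n, ∑ j ∈ Finset.Ioi i, mixed i j x * mixed i j y) +
      ∑ i : Fin n, LatticeTheta.diag i x * LatticeTheta.diag i y = zonal x y := by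
  have hxy : inner ℝ x y = ∑ i, x i * y i := by
    simp [PiLp.inner_apply, mul_comm]
  rw [zonal, hxy, sum_sq_eq_sum_sq_add, EuclideanSpace.real_norm_sq_eq,
    EuclideanSpace.real_norm_sq_eq]
  set X := ∑ i, x i ^ 2 with hX
  set Y := ∑ i, y i ^ 2 with hY
  have h1 : ∑ i : Fin n, LatticeTheta.diag i x * LatticeTheta.diag i y =
      (n : ℝ) ^ 2 * (∑ i, (x i * y i) ^ 2) - n * (X * Y) := by
    have h2 : ∀ i : Fin n, LatticeTheta.diag i x * LatticeTheta.diag i y =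
        (n : ℝ) ^ 2 * (x i * y i) ^ 2 - n * Y * x i ^ 2 - n * X * y i ^ 2 + X * Y := by
      intro i
      rw [LatticeTheta.diag, LatticeTheta.diag, ← hX, ← hY]
      ring
    simp only [h2, Finset.sum_add_distrib, Finset.sum_sub_distrib, ← Finset.mul_sum, ← hX, ← hY]
    simp
    ring
  rw [h1]
  have h3 : ∀ i j : Fin n, mixed i j x * mixed i j y = x i * y i * (x j * y j) := by
    intro i j
    rw [mixed, mixed]
    ring
  simp only [h3]
  ring

section Expansion

variable {n : ℕ} {Λ : Submodule ℤ (EuclideanSpace ℝ (Fin n))}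

lemma hasSum_quadTheta_sq {M : Matrix (Fin n) (Fin n) ℝ} {w : ℂ}
    (hs : Summable fun γ : Λ => (quadForm M γ : ℂ) * gauss w (γ : EuclideanSpace ℝ (Fin n))) :
    HasSum (fun p : Λ × Λ => ((quadForm M p.1 * quadForm M p.2 : ℝ) : ℂ) *
      (gauss w (p.1 : EuclideanSpace ℝ (Fin n)) * gauss w (p.2 : EuclideanSpace ℝ (Fin n))))
      (quadTheta Λ M w ^ 2) := by
  have h1 := summable_mul_of_summable_norm hs.norm hs.norm
  have h2 := tsum_mul_tsum_of_summable_norm hs.norm hs.norm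
  rw [sq, quadTheta, h2]
  refine h1.hasSum.congr_fun fun p => ?_
  push_cast
  ring

/-- `Θ₁₁` as a double theta series. -/
lemma hasSum_theta11 {τ : UpperHalfPlane} (hs : ∀ M : Matrix (Fin n) (Fin n) ℝ,
    Summable fun γ : Λ => (quadForm M γ : ℂ) * gauss τ (γ : EuclideanSpace ℝ (Fin n))) :
    HasSum (fun p : Λ × Λ => (zonal (p.1 : EuclideanSpace ℝ (Fin n)) p.2 : ℂ) *
      (gauss τ (p.1 : EuclideanSpace ℝ (Fin n)) * gauss τ (p.2 : EuclideanSpace ℝ (Fin n))))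
      (theta11 Λ τ) := by
  rw [theta11]
  simp only [theta_mixed, theta_diag]
  have h1 := (hasSum_sum fun i (_ : i ∈ (Finset.univ : Finset (Fin n))) =>
    hasSum_sum fun j (_ : j ∈ Finset.Ioi i) =>
      hasSum_quadTheta_sq (hs (mixedMatrix i j))).mul_left (2 * (n : ℂ) ^ 2)
  have h2 := hasSum_sum fun i (_ : i ∈ (Finset.univ : Finset (Fin n))) =>
    hasSum_quadTheta_sq (hs (diagMatrix i))
  refine (h1.add h2).congr_fun fun p => ?_
  simp only [quadForm_mixedMatrix, quadForm_diagMatrix, ← Finset.sum_mul]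
  rw [← zonal_eq_sum]
  push_cast
  ring

variable [DiscreteTopology Λ]

lemma pairs_finite (m : ℕ) : (pairs Λ m).Finite := by
  have hcl : IsClosed (Λ : Set (EuclideanSpace ℝ (Fin n))) := by
    have : DiscreteTopology Λ.toAddSubgroup := inferInstanceAs (DiscreteTopology Λ)
    exact AddSubgroup.isClosed_of_discrete (H := Λ.toAddSubgroup)
  have hfin : (Metric.closedBall (0 : EuclideanSpace ℝ (Fin n)) (Real.sqrt m) ∩ Λ).Finite :=
    Metric.finite_isBounded_inter_isClosed (s := (Λ : Set (EuclideanSpace ℝ (Fin n))))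
      (isDiscrete_iff_discreteTopology.mpr ‹_›) Metric.isBounded_closedBall hcl
  refine (hfin.prod hfin).subset ?_
  rintro ⟨x, y⟩ ⟨hx, hy, hxy⟩
  simp only at hx hy hxy
  refine ⟨⟨?_, hx⟩, ⟨?_, hy⟩⟩ <;>
  · rw [mem_closedBall_zero_iff]
    refine Real.le_sqrt_of_sq_le ?_
    nlinarith [sq_nonneg ‖x‖, sq_nonneg ‖y‖]

lemma coeff11_eq_sum (hn : 0 < n) (m : ℕ) :
    coeff11 Λ m = ∑ p ∈ (pairs_finite (Λ := Λ) m).toFinset, zonal p.1 p.2 := by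
  rw [coeff11, finsum_mem_eq_finite_toFinset_sum _ (pairs_finite m), Finset.mul_sum]
  refine Finset.sum_congr rfl fun p _ => ?_
  have hn0 : (n : ℝ) ≠ 0 := by exact_mod_cast hn.ne'
  rw [zonal]
  have h : Real.cos (InnerProductGeometry.angle p.1 p.2) * (‖p.1‖ * ‖p.2‖) = inner ℝ p.1 p.2 :=
    InnerProductGeometry.cos_angle_mul_norm_mul_norm p.1 p.2
  rw [← h]
  field_simp

variable [IsZLattice ℝ Λ]

/-- A norm-preserving additive map preserves the zonal polynomial, hence `Θ₁₁`. -/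
theorem theta11_range_eq (ι : Λ →ₗ[ℤ] EuclideanSpace ℝ (Fin n)) (hι : ∀ γ : Λ, ‖ι γ‖ = ‖γ‖) :
    theta11 (LinearMap.range ι) = theta11 Λ := by
  have hinj : Function.Injective ι := by
    rw [injective_iff_map_eq_zero]
    intro γ h
    have := hι γ
    rw [h, norm_zero] at this
    exact norm_eq_zero.mp this.symm
  let e : Λ ≃ₗ[ℤ] LinearMap.range ι := LinearEquiv.ofInjective ι hinj
  have he : ∀ γ, (e γ : EuclideanSpace ℝ (Fin n)) = ι γ := fun γ => rfl
  have hnorm : ∀ γ : Λ, ‖ι γ‖ = ‖(γ : EuclideanSpace ℝ (Fin n))‖ := fun γ => hι γ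
  have hinner : ∀ γ δ : Λ, inner ℝ (ι γ) (ι δ) =
      inner ℝ (γ : EuclideanSpace ℝ (Fin n)) (δ : EuclideanSpace ℝ (Fin n)) := by
    intro γ δ
    have h1 := norm_add_sq_real (ι γ) (ι δ)
    have h2 := norm_add_sq_real (γ : EuclideanSpace ℝ (Fin n)) δ
    rw [← map_add, hnorm, hnorm, hnorm, Submodule.coe_add] at h1
    linarith
  funext τ
  have hs' : ∀ M : Matrix (Fin n) (Fin n) ℝ, Summable fun γ : LinearMap.range ι =>
      (quadForm M γ : ℂ) * gauss τ (γ : EuclideanSpace ℝ (Fin n)) := by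
    intro M
    obtain ⟨C, hC⟩ := norm_quadForm_mul_gauss_le M (n + 1) τ.im_pos
    rw [← e.toEquiv.summable_iff]
    refine Summable.of_norm_bounded ((summable_one_add_norm_lattice (Λ := Λ)).mul_left C)
      fun γ => ?_
    have h := hC τ (ι γ) le_rfl
    rw [hnorm] at h
    exact h
  have h1 := hasSum_theta11 (τ := τ) fun M => summable_quadForm_mul_gauss (Λ := Λ) M τ.im_pos
  have h2 := hasSum_theta11 (τ := τ) hs'
  rw [← (Equiv.prodCongr e.toEquiv e.toEquiv).hasSum_iff] at h2
  refine h2.unique (h1.congr_fun fun p => ?_)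
  simp only [Function.comp_apply, Equiv.prodCongr_apply, Prod.map, LinearEquiv.coe_toEquiv, he,
    zonal, gauss, hinner, hnorm]

lemma tsum_subtype_comp_eq_sum {α β : Type*} {φ : α → β} (hφ : Function.Injective φ) {s : Set α}
    {f : β → ℂ} {T : Finset β} (hT : ∀ b, b ∈ T ↔ ∃ a ∈ s, φ a = b) :
    ∑' a : s, f (φ a) = ∑ b ∈ T, f b := by
  have hTs : (T : Set β) = φ '' s := by
    ext b
    exact hT b
  rw [← Finset.tsum_subtype' T f, hTs]
  exact (tsum_image f hφ.injOn).symm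

theorem hasSum_qExpansion_theta11 (hn : 0 < n) (hΛ : IsIntegral Λ) (τ : UpperHalfPlane) :
    HasSum (fun m : ℕ => (coeff11 Λ m : ℂ) *
      Complex.exp (2 * Real.pi * Complex.I * (τ : ℂ)) ^ m) (theta11 Λ τ) := by
  choose d hd using fun γ : Λ => hΛ γ γ.2
  have h1 := hasSum_theta11 (τ := τ) fun M => summable_quadForm_mul_gauss (Λ := Λ) M τ.im_pos
  have h2 := h1.tsum_fiberwise fun p : Λ × Λ => d p.1 + d p.2
  refine h2.congr_fun fun m => ?_
  set q := Complex.exp (2 * Real.pi * Complex.I * (τ : ℂ)) with hq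
  have hg : ∀ γ : Λ, gauss τ (γ : EuclideanSpace ℝ (Fin n)) = q ^ d γ := by
    intro γ
    rw [gauss, hd, hq, ← Complex.exp_nat_mul]
    congr 1
    push_cast
    ring
  have hterm : ∀ p : (fun p : Λ × Λ => d p.1 + d p.2) ⁻¹' {m},
      (zonal (p.1.1 : EuclideanSpace ℝ (Fin n)) p.1.2 : ℂ) *
      (gauss τ (p.1.1 : EuclideanSpace ℝ (Fin n)) * gauss τ (p.1.2 : EuclideanSpace ℝ (Fin n))) =
      ((zonal (p.1.1 : EuclideanSpace ℝ (Fin n)) p.1.2 : ℝ) : ℂ) * q ^ m := by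
    intro p
    have hp : d p.1.1 + d p.1.2 = m := p.2
    rw [hg, hg, ← pow_add, hp]
  simp only [hterm]
  rw [tsum_mul_right]
  congr 1
  rw [coeff11_eq_sum hn, Complex.ofReal_sum]
  have hinj : Function.Injective fun p : Λ × Λ =>
      ((p.1 : EuclideanSpace ℝ (Fin n)), (p.2 : EuclideanSpace ℝ (Fin n))) :=
    Subtype.val_injective.prodMap Subtype.val_injective
  refine (tsum_subtype_comp_eq_sum hinj (s := (fun p : Λ × Λ => d p.1 + d p.2) ⁻¹' {m})
    (f := fun p => ((zonal p.1 p.2 : ℝ) : ℂ)) fun b => ?_).symm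
  rw [Set.Finite.mem_toFinset]
  constructor
  · rintro ⟨h1, h2, h3⟩
    refine ⟨(⟨b.1, h1⟩, ⟨b.2, h2⟩), ?_, rfl⟩
    have h4 : ‖b.1‖ ^ 2 = d ⟨b.1, h1⟩ := hd ⟨b.1, h1⟩
    have h5 : ‖b.2‖ ^ 2 = d ⟨b.2, h2⟩ := hd ⟨b.2, h2⟩
    have h6 : (d ⟨b.1, h1⟩ : ℝ) + d ⟨b.2, h2⟩ = m := by linarith
    exact_mod_cast h6
  · rintro ⟨p, hp, rfl⟩
    have hp1 : d p.1 + d p.2 = m := hp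
    have hp2 : ((d p.1 : ℝ) + d p.2) = m := by exact_mod_cast hp1
    rw [← hd, ← hd] at hp2
    exact ⟨p.1.2, p.2.2, hp2⟩

end Expansion

section Divisibility

/-- If `σ` is an involution of `S` preserving `f`, and `P` holds for exactly one of `p`, `σ p`
wherever `f` does not vanish, then half of the sum of `f` comes from `P`. -/
lemma sum_eq_two_mul_sum_filter {α : Type*} (S : Finset α) (f : α → ℝ) (σ : α → α) (P : α → Prop)
    [DecidablePred P] (hS : ∀ p ∈ S, σ p ∈ S) (hσ : ∀ p, σ (σ p) = p) (hf : ∀ p, f (σ p) = f p)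
    (hP : ∀ p, f p ≠ 0 → (P p ↔ ¬ P (σ p))) :
    ∑ p ∈ S, f p = 2 * ∑ p ∈ S with P p, f p := by
  have h1 : ∑ p ∈ S with ¬ P p, f p = ∑ p ∈ S with P p, f p := by
    rw [Finset.sum_filter, Finset.sum_filter]
    refine Finset.sum_nbij' σ σ hS hS (fun p _ => hσ p) (fun p _ => hσ p) fun p _ => ?_
    rw [hf]
    by_cases h0 : f p = 0
    · simp [h0]
    · have := hP p h0
      by_cases h : P p
      · have h' : ¬ P (σ p) := this.mp h
        rw [if_neg (not_not.mpr h), if_neg h']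
      · have h' : P (σ p) := by
          by_contra hc
          exact h (this.mpr hc)
        rw [if_pos h, if_pos h']
  rw [← Finset.sum_filter_add_sum_filter_not S P f, h1, two_mul]

/-- A choice of one vector from each pair `{x, -x}`, `x ≠ 0`. -/
lemma exists_halfSystem (V : Type*) [AddCommGroup V] [Module ℝ V] :
    ∃ P : V → Prop, ∀ x, x ≠ 0 → (P x ↔ ¬ P (-x)) := by
  refine ⟨fun x => WellOrderingRel x (-x), fun x hx => ?_⟩
  change WellOrderingRel x (-x) ↔ ¬ WellOrderingRel (-x) (- -x)
  rw [neg_neg]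
  have hne : x ≠ -x := fun h => by
    have h2 : (2 : ℝ) • x = 0 := by
      rw [two_smul]
      nth_rewrite 2 [h]
      exact add_neg_cancel x
    exact hx ((smul_eq_zero.mp h2).resolve_left two_ne_zero)
  constructor
  · exact fun h h' => asymm h h'
  · intro h
    rcases trichotomous_of WellOrderingRel x (-x) with h1 | h1 | h1
    · exact h1
    · exact absurd h1 hne
    · exact absurd h1 h

variable {n : ℕ} {Λ : Submodule ℤ (EuclideanSpace ℝ (Fin n))}
  [DiscreteTopology Λ]

/-- The sign changes of `γ` and `δ` and the symmetry `(γ, δ) ↦ (δ, γ)` account for the divisibility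
of the coefficients: the pairs with both entries in a half system contribute a quarter of the sum,
namely `n²·(2E)/4 - n·W` with integers `E` and `W`, where `2E` is the sum of the squares of
`2⟨γ, δ⟩` and `W` that of `‖γ‖²‖δ‖²`. -/
lemma exists_coeff11_eq (hn : 0 < n) (hΛ : IsIntegral Λ) (m : ℕ) :
    ∃ E W : ℤ, coeff11 Λ m = n * (2 * n * E - 4 * W) := by
  classical
  obtain ⟨P, hP⟩ := exists_halfSystem (EuclideanSpace ℝ (Fin n))
  set S := (pairs_finite (Λ := Λ) m).toFinset with hS
  have memS : ∀ p, p ∈ S ↔ p ∈ pairs Λ m := fun p => by simp [hS]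
  set f : EuclideanSpace ℝ (Fin n) × EuclideanSpace ℝ (Fin n) → ℝ := fun p => zonal p.1 p.2 with hf
  have hf1 : ∀ p, f p ≠ 0 → p.1 ≠ 0 := by
    rintro ⟨x, y⟩ h rfl
    simp [hf, zonal] at h
  have hf2 : ∀ p, f p ≠ 0 → p.2 ≠ 0 := by
    rintro ⟨x, y⟩ h rfl
    simp [hf, zonal] at h
  have hsum1 : ∑ p ∈ S, f p = 2 * ∑ p ∈ S with P p.1, f p := by
    refine sum_eq_two_mul_sum_filter S f (fun p => (-p.1, p.2)) (fun p => P p.1) ?_ ?_ ?_ ?_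
    · intro p hp
      rw [memS] at hp ⊢
      exact ⟨Λ.neg_mem hp.1, hp.2.1, by simpa using hp.2.2⟩
    · simp
    · intro p
      simp [hf, zonal]
    · exact fun p hp => hP _ (hf1 p hp)
  have hsum2 : ∑ p ∈ S with P p.1, f p = 2 * ∑ p ∈ (S.filter fun p => P p.1) with P p.2, f p := by
    refine sum_eq_two_mul_sum_filter _ f (fun p => (p.1, -p.2)) (fun p => P p.2) ?_ ?_ ?_ ?_
    · intro p hp
      rw [Finset.mem_filter, memS] at hp ⊢
      exact ⟨⟨hp.1.1, Λ.neg_mem hp.1.2.1, by simpa using hp.1.2.2⟩, hp.2⟩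
    · simp
    · intro p
      simp [hf, zonal]
    · exact fun p hp => hP _ (hf2 p hp)
  set S' := (S.filter fun p => P p.1).filter fun p => P p.2 with hS'
  have memS' : ∀ p, p ∈ S' ↔ p ∈ pairs Λ m ∧ P p.1 ∧ P p.2 := fun p => by
    rw [hS', Finset.mem_filter, Finset.mem_filter, memS, and_assoc]
  set t : EuclideanSpace ℝ (Fin n) × EuclideanSpace ℝ (Fin n) → ℤ :=
    fun p => ⌊2 * inner ℝ p.1 p.2⌋ with ht
  set w : EuclideanSpace ℝ (Fin n) × EuclideanSpace ℝ (Fin n) → ℤ :=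
    fun p => ⌊‖p.1‖ ^ 2 * ‖p.2‖ ^ 2⌋ with hw
  have ht' : ∀ p ∈ S', (t p : ℝ) = 2 * inner ℝ p.1 p.2 := by
    intro p hp
    rw [memS'] at hp
    obtain ⟨s, hs⟩ := mem_dual_of_isIntegral hΛ hp.1.2.1 p.1 hp.1.1
    rw [ht]
    simp only
    rw [hs, Int.floor_intCast]
  have hw' : ∀ p ∈ S', (w p : ℝ) = ‖p.1‖ ^ 2 * ‖p.2‖ ^ 2 := by
    intro p hp
    rw [memS'] at hp
    obtain ⟨s, hs⟩ := hΛ _ hp.1.1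
    obtain ⟨r, hr⟩ := hΛ _ hp.1.2.1
    rw [hw]
    simp only
    rw [hs, hr, ← Nat.cast_mul, Int.floor_natCast, Int.cast_natCast]
  -- modulo `2` the pairs off the diagonal cancel under the swap, and `2⟨γ, γ⟩` is even
  have heven : ((∑ p ∈ S', t p ^ 2 : ℤ) : ZMod 2) = 0 := by
    push_cast
    refine Finset.sum_involution (fun p _ => p.swap) ?_ ?_ ?_ ?_
    · intro p _
      have : t p.swap = t p := by simp only [ht, Prod.fst_swap, Prod.snd_swap, real_inner_comm]
      rw [this, CharTwo.add_self_eq_zero]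
    · intro p hp hne heq
      apply hne
      have h1 : p.2 = p.1 := congrArg Prod.fst heq
      have hp' := (memS' p).mp hp
      obtain ⟨s, hs⟩ := hΛ _ hp'.1.1
      have h2 : t p = 2 * s := by
        have := ht' p hp
        rw [h1, real_inner_self_eq_norm_sq, hs] at this
        exact_mod_cast this
      rw [h2]
      push_cast
      rw [show (2 : ZMod 2) = 0 from rfl]
      ring
    · intro p hp
      rw [memS'] at hp ⊢
      exact ⟨⟨hp.1.2.1, hp.1.1, by
        have := hp.1.2.2
        rw [Prod.fst_swap, Prod.snd_swap]
        linarith⟩, hp.2.2, hp.2.1⟩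
    · intro p _
      exact Prod.swap_swap p
  obtain ⟨E, hE⟩ := (ZMod.intCast_zmod_eq_zero_iff_dvd _ 2).mp heven
  refine ⟨E, ∑ p ∈ S', w p, ?_⟩
  have hE' : ∑ p ∈ S', (t p : ℝ) ^ 2 = 2 * E := by exact_mod_cast hE
  rw [coeff11_eq_sum hn]
  change ∑ p ∈ S, f p = _
  have hterm : ∑ p ∈ S', f p = (n : ℝ) ^ 2 / 4 * ∑ p ∈ S', (t p : ℝ) ^ 2 -
      n * ∑ p ∈ S', (w p : ℝ) := by
    rw [Finset.mul_sum, Finset.mul_sum, ← Finset.sum_sub_distrib]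
    refine Finset.sum_congr rfl fun p hp => ?_
    rw [ht' p hp, hw' p hp, hf]
    simp only [zonal]
    ring
  rw [hsum1, hsum2, hterm, hE']
  push_cast
  ring

lemma coeff11_eq_zero (hn : 0 < n) {k m : ℕ} (hk : IsMinimalLength Λ k) (hm : m < 2 * k)
    (hΛ : IsIntegral Λ) : coeff11 Λ m = 0 := by
  rw [coeff11_eq_sum hn]
  refine Finset.sum_eq_zero fun p hp => ?_
  rw [Set.Finite.mem_toFinset] at hp
  by_cases h1 : p.1 = 0
  · simp [zonal, h1]
  by_cases h2 : p.2 = 0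
  · simp [zonal, h2]
  exfalso
  obtain ⟨a, ha⟩ := hΛ _ hp.1
  obtain ⟨b, hb⟩ := hΛ _ hp.2.1
  have hka := hk.2 ⟨p.1, hp.1, h1, ha⟩
  have hkb := hk.2 ⟨p.2, hp.2.1, h2, hb⟩
  have hab := hp.2.2
  rw [ha, hb] at hab
  have : a + b = m := by exact_mod_cast hab
  omega

lemma mem_span_C_mul_X_pow {R : Type*} [CommRing R] (a : R) (d : ℕ) (S : PowerSeries R)
    (z : ℕ → R) (hz : ∀ m, PowerSeries.coeff m S = a * z m) (h0 : ∀ m < d, z m = 0) :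
    S ∈ Ideal.span {PowerSeries.C a * PowerSeries.X ^ d} := by
  rw [Ideal.mem_span_singleton]
  refine ⟨PowerSeries.mk fun m => z (m + d), ?_⟩
  ext m
  rw [hz, mul_assoc, PowerSeries.coeff_C_mul, PowerSeries.coeff_X_pow_mul']
  split_ifs with h
  · rw [PowerSeries.coeff_mk, Nat.sub_add_cancel h]
  · rw [h0 m (not_le.mp h)]

theorem exists_powerSeries_coeff11 (hn : 0 < n) (hΛ : IsIntegral Λ) {k : ℕ}
    (hk : IsMinimalLength Λ k) :
    ∃ S : PowerSeries ℤ, (∀ m : ℕ, ((PowerSeries.coeff m S : ℤ) : ℝ) = coeff11 Λ m) ∧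
      S ∈ Ideal.span {PowerSeries.C (2 * (n : ℤ)) * PowerSeries.X ^ (2 * k)} ∧
      (Even n → S ∈ Ideal.span {PowerSeries.C (4 * (n : ℤ)) * PowerSeries.X ^ (2 * k)}) := by
  choose E W hEW using exists_coeff11_eq (Λ := Λ) hn hΛ
  have hnZ : (n : ℤ) ≠ 0 := by exact_mod_cast hn.ne'
  have hlow : ∀ m < 2 * k, 2 * (n : ℤ) * (n * E m - 2 * W m) = 0 := by
    intro m hm
    have h := hEW m
    rw [coeff11_eq_zero hn hk hm hΛ] at h
    have : ((2 * (n : ℤ) * (n * E m - 2 * W m) : ℤ) : ℝ) = 0 := by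
      push_cast
      linarith
    exact_mod_cast this
  refine ⟨PowerSeries.mk fun m => 2 * (n : ℤ) * (n * E m - 2 * W m), fun m => ?_, ?_, ?_⟩
  · rw [PowerSeries.coeff_mk, hEW]
    push_cast
    ring
  · refine mem_span_C_mul_X_pow _ _ _ (fun m => n * E m - 2 * W m)
      (fun m => PowerSeries.coeff_mk _ _) fun m hm => ?_
    exact (mul_eq_zero.mp (hlow m hm)).resolve_left (mul_ne_zero two_ne_zero hnZ)
  · rintro ⟨r, hr⟩
    have hr' : (n : ℤ) = 2 * r := by omega
    refine mem_span_C_mul_X_pow _ _ _ (fun m => r * E m - W m)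
      (fun m => ?_) fun m hm => ?_
    · rw [PowerSeries.coeff_mk]
      linear_combination (2 * (n : ℤ) * E m) * hr'
    · have h := hlow m hm
      have h2 : 4 * (n : ℤ) * (r * E m - W m) = 0 := by
        rw [← h]
        linear_combination (-(2 * (n : ℤ) * E m)) * hr'
      exact (mul_eq_zero.mp h2).resolve_left (mul_ne_zero (by norm_num) hnZ)

end Divisibility

end QExpansion

end LatticeTheta

/-! ### Modularity and integrality of `Θ₁₁` -/

theorem theorem4p1 (n : ℕ) (hn : 0 < n) (Λ : Submodule ℤ (EuclideanSpace ℝ (Fin n)))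
    [DiscreteTopology Λ] [IsZLattice ℝ Λ] (hΛ : LatticeTheta.IsIntegral Λ)
    (N : ℕ) (hN : LatticeTheta.IsLevel Λ N)
    (k : ℕ) (hk : LatticeTheta.IsMinimalLength Λ k) :
    -- the theta series involved converge absolutely
    (∀ (τ : UpperHalfPlane) (i : Fin n),
      Summable (fun γ : Λ => LatticeTheta.thetaTerm (LatticeTheta.diag i) τ γ) ∧
      ∀ j : Fin n, i < j →
        Summable (fun γ : Λ => LatticeTheta.thetaTerm (LatticeTheta.mixed i j) τ γ)) ∧
    -- independence of the isometric embedding into Euclidean space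
    (∀ ι : Λ →ₗ[ℤ] EuclideanSpace ℝ (Fin n), (∀ γ : Λ, ‖ι γ‖ = ‖γ‖) →
      LatticeTheta.theta11 (LinearMap.range ι) = LatticeTheta.theta11 Λ) ∧
    -- cusp form of weight `n + 4` and level `N`; trivial character for even `n`
    (Even n → ∃ F : CuspForm ((CongruenceSubgroup.Gamma0 N).map
        (Matrix.SpecialLinearGroup.mapGL ℝ)) ((n : ℤ) + 4), ⇑F = LatticeTheta.theta11 Λ) ∧
    -- for odd `n` the weight is odd, and the character is `d ↦ (-1 / d)`
    (Odd n →
      (∃ F : CuspForm ((CongruenceSubgroup.Gamma1 N).map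
        (Matrix.SpecialLinearGroup.mapGL ℝ)) ((n : ℤ) + 4), ⇑F = LatticeTheta.theta11 Λ) ∧
      ∀ g ∈ CongruenceSubgroup.Gamma0 N,
        LatticeTheta.theta11 Λ ∣[(n : ℤ) + 4] g =
          (((ZMod.χ₄ ((g 1 1 : ℤ) : ZMod 4) : ℤ) : ℂ)) • LatticeTheta.theta11 Λ) ∧
    -- the `q`-expansion
    (∀ m : ℕ, (LatticeTheta.pairs Λ m).Finite) ∧
    (∀ τ : UpperHalfPlane, HasSum
      (fun m : ℕ => (LatticeTheta.coeff11 Λ m : ℂ) *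
        Complex.exp (2 * Real.pi * Complex.I * (τ : ℂ)) ^ m)
      (LatticeTheta.theta11 Λ τ)) ∧
    -- integrality and divisibility of the `q`-expansion
    (∃ S : PowerSeries ℤ, (∀ m : ℕ, ((PowerSeries.coeff m S : ℤ) : ℝ) = LatticeTheta.coeff11 Λ m) ∧
      S ∈ Ideal.span {PowerSeries.C (2 * (n : ℤ)) * PowerSeries.X ^ (2 * k)} ∧
      (Even n → S ∈ Ideal.span {PowerSeries.C (4 * (n : ℤ)) * PowerSeries.X ^ (2 * k)})) := by
  have hN0 : NeZero N := ⟨hN.1.1.ne'⟩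
  have hdual : ∀ y ∈ LatticeTheta.dual Λ, ∃ m : ℤ, ((N : ℤ) : ℝ) * ‖y‖ ^ 2 = m := fun y hy => by
    rw [Int.cast_natCast]
    exact hN.1.2 y hy
  have hG0 : ∀ g ∈ CongruenceSubgroup.Gamma0 N, (N : ℤ) ∣ g 1 0 := fun g hg =>
    (ZMod.intCast_zmod_eq_zero_iff_dvd _ N).mp (CongruenceSubgroup.Gamma0_mem.mp hg)
  refine ⟨fun τ i => ⟨?_, fun j _ => ?_⟩, fun ι hι => LatticeTheta.theta11_range_eq ι hι,
    fun he => ?_,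
    fun ho => ⟨?_, fun g hg => LatticeTheta.theta11_slash_of_odd ho hΛ hdual (hG0 g hg)⟩,
    LatticeTheta.pairs_finite,
    LatticeTheta.hasSum_qExpansion_theta11 hn hΛ, LatticeTheta.exists_powerSeries_coeff11 hn hΛ hk⟩
  · have h := LatticeTheta.summable_quadForm_mul_gauss (Λ := Λ) (LatticeTheta.diagMatrix i) τ.im_pos
    simp only [LatticeTheta.quadForm_diagMatrix] at h
    exact h
  · have h := LatticeTheta.summable_quadForm_mul_gauss (Λ := Λ)
      (LatticeTheta.mixedMatrix i j) τ.im_pos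
    simp only [LatticeTheta.quadForm_mixedMatrix] at h
    exact h
  · exact LatticeTheta.exists_cuspForm_theta11 hΛ hdual (CongruenceSubgroup.Gamma0 N) fun g hg =>
      LatticeTheta.theta11_slash_of_even he hΛ hdual (hG0 g hg)
  · refine LatticeTheta.exists_cuspForm_theta11 hΛ hdual (CongruenceSubgroup.Gamma1 N)
      fun g hg => ?_
    obtain ⟨-, h11, h10⟩ := (CongruenceSubgroup.Gamma1_mem N g).mp hg
    refine LatticeTheta.theta11_slash_Gamma1_of_odd ho hΛ hdual
      ((ZMod.intCast_zmod_eq_zero_iff_dvd _ N).mp h10)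
      ((ZMod.intCast_zmod_eq_zero_iff_dvd _ N).mp ?_)
    rw [Int.cast_sub, h11, Int.cast_one, sub_self]
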